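/- **Setting.** Phase space is $\mathbb R^{2N}$ with coordinates $q_1,p_1,\dots,q_N,p_N$. For each of these coordinates fix a $\sigma$-finite Borel reference measure on $\mathbb R$, written $dq_j$, $dp_j$ (Lebesgue measure, or e.g. Lebesgue measure plus point masses); all densities are taken with respect to the corresponding product measures. A *vertex* $\alpha$ is a choice $x_j\in\{q_j,p_j\}$ for every $j$; $Z_\alpha=(x_1,\dots,x_N)$ denotes its variables and $Z'_\alpha$ the conjugate ones. Two vertices are *contiguous* if they differ by the assignment of exactly one variable, whose index $j$ is the index of the pair. A finite set of vertices is regarded as a graph $G$ by joining contiguous vertices; it is *proper* if no two of its links have the same index. A *chain of type $G$* is a family of probability densities $\sigma_\alpha(Z_\alpha)$, $\alpha\in G$, that are mutually compatible: $\int dY\,\sigma_\alpha(X,Y)=\int dY'\,\sigma_\beta(X,Y')$ a.e., where $X$ are the common variables of $\alpha,\beta$, and $Z_\alpha=(X,Y)$, $Z_\beta=(X,Y')$. A density $\rho$ on phase space *reproduces* the chain if $\int dZ'_\alpha\,\rho=\sigma_\alpha(Z_\alpha)$ a.e. for every $\alpha\in G$. Let $G\subseteq G_c$ with $G_c$ connected,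 proper and *$G$-simple*, i.e. every vertex of $G_c$ not in $G$ (an insertion) has exactly two legs in $G_c$. (The case $G_c=G$ is that of a connected proper $G$.) A *link* $l$ is a pair $\{\alpha_l,\beta_l\}$ of distinct vertices of $G$ joined by a path in $G_c$ all of whose intermediate vertices are insertions (*composite* link, if there are any; for $G_c=G$ the links are the pairs of contiguous vertices). Let $\sigma_{\alpha_l\beta_l}(X_l)=\int dY_l\,\sigma_{\alpha_l}(X_l,Y_l)$, where $X_l$ are the common variables of $\alpha_l$ and $\beta_l$, and let $T'$ be the conjugates of the variables which have the same assignment in all vertices of $G$. Given a chain of type $G$ and a density $\zeta(T')\ge0$ with $\int dT'\,\zeta=1$, put $$\rho_0=\Big(\prod_{\alpha\in G}\sigma_\alpha(Z_\alpha)\Big)\Big(\prod_{l}\frac1{\sigma_{\alpha_l\beta_l}(X_l)}\Big)\zeta(T'),$$ where $1/\sigma_{\alpha_l\beta_l}$ is read as $0$ where $\sigma_{\alpha_l\beta_l}=0$ (and likewise $1/\sigma_\alpha$ below). **Theorem.** 1. $\rho_0$ is a probability density on phase space and reproduces the chain. 2. The formula $P_\alpha g=\frac1{\sigma_\alpha(Z_\alpha)}\int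 dZ'_\alpha\,\rho_0\,g$ defines a continuous linear projector on $L^1(\rho_0\,d^Nq\,d^Np)$ for every $\alpha\in G$. The operator $$\Pi=1-\sum_{\alpha\in G} P_\alpha+\sum_l P_{\alpha_l}P_{\beta_l}$$ is a projector, $P_\alpha\Pi=0$ for all $\alpha\in G$, and $h\in L^1(\rho_0\,d^Nq\,d^Np)$ satisfies $P_\alpha h=0$ for all $\alpha\in G$ if and only if $h=\Pi f$ for some $f\in L^1(\rho_0\,d^Nq\,d^Np)$. Explicitly, $\rho_0$-almost everywhere, $$\Pi f=f-\sum_{\alpha\in G}\frac1{\sigma_\alpha(Z_\alpha)}\int dZ'_\alpha\,\rho_0 f+\sum_l\frac1{\sigma_{\alpha_l\beta_l}(X_l)}\int dX'_l\,dY_l\,dY'_l\;\rho_0 f .$$ 3. For all $f\in L^1(\rho_0\,d^Nq\,d^Np)$ and $\lambda\in\mathbb R$, with $h=\Pi f$, the function $\rho_0(1+\lambda h)$ is integrable and satisfies $\int dZ'_\alpha\,\rho_0(1+\lambda h)=\sigma_\alpha$ a.e. for every $\alpha\in G$. Let $m_+$ and $-m_-$ be the essential supremum and infimum of $h$ with respect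 to $\rho_0\,d^Nq\,d^Np$. If $h\neq0$, then $m_\pm\in(0,\infty]$, and $\rho_0(1+\lambda h)\ge0$ a.e. if and only if $$-\frac1{m_+}\le\lambda\le\frac1{m_-}\qquad(1/\infty=0);$$ if $h=0$ every $\lambda$ is allowed. 4. A function $\rho$ on phase space is a probability density that reproduces the chain and vanishes a.e. on $\{\zeta=0\}$ if and only if $\rho=\rho_0(1+\lambda\,\Pi f)$ a.e. for some $f\in L^1(\rho_0\,d^Nq\,d^Np)$ and some $\lambda$ in the range given in 3. In particular, if $\zeta>0$ a.e., every probability density reproducing the chain has this form. -/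

import Mathlib

open MeasureTheory Finset

namespace CCS

/-- The type of a CCS-distribution in `N` dimensions, i.e. a choice of `x_j = q_j` (`false`) or
`x_j = p_j` (`true`) for every index `j`.  These are the possible vertices of graphs. -/
abbrev Vertex (N : ℕ) := Fin N → Bool

/-- Phase space `ℝ^{2N}`: the coordinate `(j, false)` is `q_j`, the coordinate `(j, true)` is
`p_j`. -/
abbrev Phase (N : ℕ) := Fin N × Bool → ℝ

variable {N : ℕ}

/-- The variables `Z_a = (x_1, …, x_N)` of a vertex; the conjugate variables `Z_a'` are the
complement `(args a)ᶜ`. -/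
def args (a : Vertex N) : Finset (Fin N × Bool) := univ.filter fun i => i.2 = a i.1

/-! ### Graphs -/

/-- Two vertices are contiguous if they differ by the assignment of exactly one variable. -/
def contiguity (N : ℕ) : SimpleGraph (Vertex N) where
  Adj a b := ∃! j, a j ≠ b j
  symm := ⟨fun _ _ ⟨j, hj, hu⟩ => ⟨j, hj.symm, fun k hk => hu k (Ne.symm hk)⟩⟩
  loopless := ⟨fun _ ⟨_, hj, _⟩ => hj rfl⟩

/-- The graph associated to a finite set `V` of vertices (the type of a chain). -/
def graph (V : Finset (Vertex N)) : SimpleGraph {a // a ∈ V} :=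
  (contiguity N).comap Subtype.val

/-- A graph is proper if no two links have the same index. -/
def IsProper (V : Finset (Vertex N)) : Prop :=
  ∀ a ∈ V, ∀ b ∈ V, ∀ c ∈ V, ∀ d ∈ V, (contiguity N).Adj a b → (contiguity N).Adj c d →
    ∀ j, a j ≠ b j → c j ≠ d j → s(a, b) = s(c, d)

/-- The graph of `Vc` is `V`-simple: every insertion (vertex of `Vc` which is not in `V`) has
exactly two legs. -/
def IsSimple (V Vc : Finset (Vertex N)) : Prop :=
  ∀ c ∈ Vc, c ∉ V → {d | d ∈ Vc ∧ (contiguity N).Adj c d}.ncard = 2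

/-- The vertices `a ≠ b` of `V` are joined by a link, simple or composite: there is a path from
`a` to `b` in the graph of `Vc` whose intermediate vertices are all insertions.  For `Vc = V` there
are no insertions and the links are exactly the pairs of contiguous vertices of `V`. -/
def IsLink (V Vc : Finset (Vertex N)) (a b : Vertex N) : Prop :=
  a ∈ V ∧ b ∈ V ∧ a ≠ b ∧ ∃ p : (contiguity N).Walk a b, p.IsPath ∧
    ∀ c ∈ p.support, c ∈ Vc ∧ (c ∈ V → c = a ∨ c = b)

/-- `L` lists every link exactly once, as a pair `(α_l, β_l)` of its two end points in an
arbitrary order. -/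
structure IsLinkList (V Vc : Finset (Vertex N)) (L : Finset (Vertex N × Vertex N)) : Prop where
  isLink : ∀ a b, (a, b) ∈ L → IsLink V Vc a b
  complete : ∀ a b, IsLink V Vc a b → (a, b) ∈ L ∨ (b, a) ∈ L
  once : ∀ a b, (a, b) ∈ L → (b, a) ∉ L

/-! ### Distributions

All densities are taken with respect to the reference measures `ν (j, false)` for `dq_j` and
`ν (j, true)` for `dp_j`, e.g. Lebesgue measure.  Functions of some of the variables only are
regarded as functions on phase space which depend on these variables only. -/

noncomputable section

/-- The function `∫ dS g`: integration of `g` over the variables in `S`, the other ones being kept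
fixed. -/
def integrate (ν : Fin N × Bool → Measure ℝ) (S : Finset (Fin N × Bool)) (g : Phase N → ℝ)
    (z : Phase N) : ℝ :=
  ∫ y : S → ℝ, g (Function.updateFinset z S y) ∂Measure.pi fun i : S => ν i

/-- A chain of type `V`: a family of mutually compatible CCS-distributions (given by probability
densities), one for each vertex of `V`. -/
structure IsChain (ν : Fin N × Bool → Measure ℝ) (V : Finset (Vertex N))
    (σ : Vertex N → Phase N → ℝ) : Prop where
  measurable : ∀ a ∈ V, Measurable (σ a)
  dependsOn : ∀ a ∈ V, DependsOn (σ a) (args a : Set (Fin N × Bool))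
  nonneg : ∀ a ∈ V, ∀ z, 0 ≤ σ a z
  normalized : ∀ a ∈ V, ∀ z, integrate ν (args a) (σ a) z = 1
  compatible : ∀ a ∈ V, ∀ b ∈ V, ∀ᵐ z ∂Measure.pi ν,
    integrate ν (args a \ args b) (σ a) z = integrate ν (args b \ args a) (σ b) z

/-- Phase space probability densities. -/
structure IsDensity (ν : Fin N × Bool → Measure ℝ) (ρ : Phase N → ℝ) : Prop where
  integrable : Integrable ρ (Measure.pi ν)
  nonneg : ∀ᵐ z ∂Measure.pi ν, 0 ≤ ρ z
  normalized : ∫ z, ρ z ∂Measure.pi ν = 1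

/-- `ρ` reproduces the chain: `σ_a(Z_a) = ∫ dZ_a' ρ` for every vertex `a` in `V`. -/
def Reproduces (ν : Fin N × Bool → Measure ℝ) (V : Finset (Vertex N))
    (σ : Vertex N → Phase N → ℝ) (ρ : Phase N → ℝ) : Prop :=
  ∀ a ∈ V, ∀ᵐ z ∂Measure.pi ν, integrate ν (args a)ᶜ ρ z = σ a z

/-- The conjugates `T'` of the passive variables `T`, i.e. of the variables with the same
assignment in all the vertices of `V`. -/
def passiveConj (V : Finset (Vertex N)) : Finset (Fin N × Bool) :=
  univ.filter fun i => ∀ a ∈ V, i ∉ args a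

/-- A normalized density of the variables `T'`. -/
structure IsPassiveDensity (ν : Fin N × Bool → Measure ℝ) (V : Finset (Vertex N))
    (ζ : Phase N → ℝ) : Prop where
  measurable : Measurable ζ
  dependsOn : DependsOn ζ (passiveConj V : Set (Fin N × Bool))
  nonneg : ∀ z, 0 ≤ ζ z
  normalized : ∀ z, integrate ν (passiveConj V) ζ z = 1

/-- The integrated distribution `σ_{ab}(X) = ∫ dY σ_a(X, Y)` of the link `(a, b)`, where `X`
consists of the common variables of `a` and `b`. -/
def linkMarginal (ν : Fin N × Bool → Measure ℝ) (σ : Vertex N → Phase N → ℝ)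
    (l : Vertex N × Vertex N) : Phase N → ℝ :=
  integrate ν (args l.1 \ args l.2) (σ l.1)

/-- The propagator `1 / σ_{ab}` on the support of `σ_{ab}`, and `0` elsewhere. -/
def propagator (ν : Fin N × Bool → Measure ℝ) (σ : Vertex N → Phase N → ℝ)
    (l : Vertex N × Vertex N) (z : Phase N) : ℝ :=
  if linkMarginal ν σ l z = 0 then 0 else 1 / linkMarginal ν σ l z

/-- The particular solution `ρ_0`: vertex functions times propagators times `ζ(T')`. -/
def rho0 (ν : Fin N × Bool → Measure ℝ) (V : Finset (Vertex N)) (L : Finset (Vertex N × Vertex N))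
    (σ : Vertex N → Phase N → ℝ) (ζ : Phase N → ℝ) (z : Phase N) : ℝ :=
  (∏ a ∈ V, σ a z) * (∏ l ∈ L, propagator ν σ l z) * ζ z

/-- The measure `r dq dp`. -/
def weighted (ν : Fin N × Bool → Measure ℝ) (r : Phase N → ℝ) : Measure (Phase N) :=
  (Measure.pi ν).withDensity fun z => ENNReal.ofReal (r z)

/-- `∫ dμ_a g = (1 / σ_a(Z_a)) ∫ dZ_a' r g` on the support of `σ_a`, and `0` elsewhere. -/
def vertexMean (ν : Fin N × Bool → Measure ℝ) (σ : Vertex N → Phase N → ℝ) (r : Phase N → ℝ)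
    (a : Vertex N) (g : Phase N → ℝ) (z : Phase N) : ℝ :=
  if σ a z = 0 then 0 else 1 / σ a z * integrate ν (args a)ᶜ (fun w => r w * g w) z

/-- `(1 / σ_{ab}(X)) ∫ dX' dY dY' r g` on the support of `σ_{ab}`, and `0` elsewhere. -/
def linkMean (ν : Fin N × Bool → Measure ℝ) (σ : Vertex N → Phase N → ℝ) (r : Phase N → ℝ)
    (l : Vertex N × Vertex N) (g : Phase N → ℝ) (z : Phase N) : ℝ :=
  propagator ν σ l z * integrate ν (args l.1 ∩ args l.2)ᶜ (fun w => r w * g w) z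

/-- `m_+`, the essential supremum of `h` (possibly `∞`). -/
def mPlus (μ : Measure (Phase N)) (h : Phase N → ℝ) : EReal := essSup (fun z => (h z : EReal)) μ

/-- `m_-`, where `-m_-` is the essential infimum of `h` (possibly `-∞`). -/
def mMinus (μ : Measure (Phase N)) (h : Phase N → ℝ) : EReal := -essInf (fun z => (h z : EReal)) μ

/-- `-1/m_+ ≤ t ≤ 1/m_-`, with `1/∞ = 0`; no condition on `t` if `h` vanishes identically. -/
def InRange (μ : Measure (Phase N)) (h : Phase N → ℝ) (t : ℝ) : Prop :=
  h =ᵐ[μ] 0 ∨ (-(1 / mPlus μ h) ≤ (t : EReal) ∧ (t : EReal) ≤ 1 / mMinus μ h)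

end

end CCS

/-! The chain behaves like a tree-indexed Markov field. Properness and simplicity imply that two
distinct links never change the same variable. Hence, whatever root a is chosen, the vertices can be
attached one at a time to a growing set W so that the new vertex b has exactly one link into W, to
some c, and every variable of b already present in W is a variable of c. This is the running
intersection property of a junction tree (`JunctionTree`, `junctionTree_of_isLinkList`).

Reproduction follows by removing leaves. The variables Y of b that are not in c occur in no other
factor than σ_b, and ∫ dY σ_b = σ_bc cancels the propagator. Where σ_bc = 0, the factor σ_c also
vanishes a.e., so the default value 0 is harmless (`IsChain.lmarginal_leaf`). Iterating down to the
root leaves σ_a, and the root is arbitrary.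

The operators P_a are conditional expectations E[· | Z_a] for the probability measure ρ₀ dq dp;
write E_S for conditioning on the variables S. The same factorization gives the Markov property E_W
E_b = E_X, where X are the common variables of b and c (`IsChain.condExpOp_leaf`). Since E_a E_W =
E_a, attaching b adds E_a E_b = E_a E_X, so vertices other than the root and links pair off: Σ_b E_a
E_b = E_a + Σ_l E_a E_{X_l}. For a link starting at the root, E_X absorbs E_a, so P_α P_β = E_{X_l}
(`JunctionTree.condExpOp_root`). Together these give P_a Π = 0. Conversely Π fixes the common kernel
of the P_a, because every other term of Π ends in some P_a. So Π is a projector onto that kernel.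

The linear equations for ρ₀(1 + λh) amount to P_a h = 0. Such an h has mean zero, which makes m_±
positive when h ≠ 0. A solution ρ vanishing with ζ vanishes wherever ρ₀ does, so ρ = ρ₀(1 + h) with
h = ρ/ρ₀ − 1 in the common kernel. -/

namespace CCS

/-! ### Graphs: links have disjoint index sets, and the vertices form a junction tree. -/

section Combinatorics

variable {N : ℕ}

/-- `JunctionTree a W M`: the vertices `W` can be listed, starting with the root `a`, in such a way
that every other vertex `b` is joined by a unique link of `M` to an earlier vertex `c` which contains
all the variables that `b` has in common with the earlier vertices. -/
inductive JunctionTree (a : Vertex N) :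
    Finset (Vertex N) → Finset (Vertex N × Vertex N) → Prop
  | root : JunctionTree a {a} ∅
  | step {W : Finset (Vertex N)} {M : Finset (Vertex N × Vertex N)} {b c : Vertex N}
      {l : Vertex N × Vertex N} (h : JunctionTree a W M) (hc : c ∈ W) (hb : b ∉ W)
      (hl : l = (b, c) ∨ l = (c, b)) (hlM : l ∉ M)
      (hsep : ∀ d ∈ W, ∀ j, d j = b j → c j = b j) :
      JunctionTree a (insert b W) (insert l M)

theorem JunctionTree.root_mem {a : Vertex N} {W : Finset (Vertex N)}
    {M : Finset (Vertex N × Vertex N)} (h : JunctionTree a W M) : a ∈ W := by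
  induction h with
  | root => simp
  | step _ _ _ _ _ _ ih => exact mem_insert_of_mem ih

theorem JunctionTree.mem_of_mem {a : Vertex N} {W : Finset (Vertex N)}
    {M : Finset (Vertex N × Vertex N)} (h : JunctionTree a W M) :
    ∀ l ∈ M, l.1 ∈ W ∧ l.2 ∈ W := by
  induction h with
  | root => simp
  | step _ hc hb hl _ _ ih => grind

theorem IsLink.symm {V Vc : Finset (Vertex N)} {a b : Vertex N} (h : IsLink V Vc a b) :
    IsLink V Vc b a := by
  obtain ⟨ha, hb, hab, p, hp, hs⟩ := h
  refine ⟨hb, ha, hab.symm, p.reverse, hp.reverse, fun c hc => ?_⟩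
  rw [SimpleGraph.Walk.support_reverse, List.mem_reverse] at hc
  exact ⟨(hs c hc).1, fun h => ((hs c hc).2 h).symm⟩

/-- A path along which the `j`-th variable changes has a link with index `j`. -/
theorem exists_adj_of_ne {a b : Vertex N} (p : (contiguity N).Walk a b) (hp : p.IsPath) {j : Fin N}
    (hj : a j ≠ b j) : ∃ (u w : Vertex N) (p₁ : (contiguity N).Walk u a)
      (p₂ : (contiguity N).Walk w b), (contiguity N).Adj u w ∧ u j ≠ w j ∧ p₁.IsPath ∧ p₂.IsPath ∧
      w ∉ p₁.support ∧ u ∉ p₂.support ∧ (∀ x ∈ p₁.support, x ∈ p.support ∧ x ≠ b) ∧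
      ∀ x ∈ p₂.support, x ∈ p.support ∧ x ≠ a := by
  -- The edge found is the first one at which the `j`-th variable changes; `p₁` runs backwards from
  -- it to `a`, and `p₂` forwards to `b`.
  induction p with
  | nil => exact absurd rfl hj
  | @cons a x b h p ih =>
    rw [SimpleGraph.Walk.cons_isPath_iff] at hp
    obtain ⟨hp, ha⟩ := hp
    by_cases hx : a j = x j
    · obtain ⟨u, w, p₁, p₂, huw, hne, h₁, h₂, hw, hu, hs₁, hs₂⟩ := ih hp (hx ▸ hj)
      refine ⟨u, w, p₁.concat h.symm, p₂, huw, hne, ?_, h₂, ?_, hu, ?_, ?_⟩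
      · exact h₁.concat (fun h' => ha (hs₁ _ h').1) _
      · rw [SimpleGraph.Walk.support_concat]
        intro h'
        have h' : w ∈ p₁.support ∨ w = a := by simpa using h'
        rcases h' with h' | h'
        · exact hw h'
        · have := (hs₂ w p₂.start_mem_support).1
          exact ha (h' ▸ this)
      · intro y hy
        rw [SimpleGraph.Walk.support_concat] at hy
        simp only [SimpleGraph.Walk.support_cons, List.mem_cons]
        have hy : y ∈ p₁.support ∨ y = a := by simpa using hy
        rcases hy with h' | h'
        · exact ⟨Or.inr (hs₁ y h').1, (hs₁ y h').2⟩
        · exact ⟨Or.inl h', fun hb => ha (by rw [← h', hb]; exact p.end_mem_support)⟩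
      · intro y hy
        simp only [SimpleGraph.Walk.support_cons, List.mem_cons]
        exact ⟨Or.inr (hs₂ y hy).1, fun h' => ha (h' ▸ (hs₂ y hy).1)⟩
    · refine ⟨a, x, .nil, p, h, hx, by simp, hp, ?_, ha, ?_, ?_⟩
      · simpa using h.ne'
      · intro y hy
        obtain rfl : y = a := by simpa using hy
        exact ⟨SimpleGraph.Walk.start_mem_support _, fun h' => ha (h' ▸ p.end_mem_support)⟩
      · intro y hy
        simp only [SimpleGraph.Walk.support_cons, List.mem_cons]
        exact ⟨Or.inr hy, fun h' => ha (h' ▸ hy)⟩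

/-- Through insertions, which have exactly two legs, a path can be continued in a unique way. -/
theorem end_eq_of_common_adj {V Vc : Finset (Vertex N)} (hsimple : IsSimple V Vc)
    {w b : Vertex N} (p : (contiguity N).Walk w b) {u d : Vertex N}
    (q : (contiguity N).Walk w d) (hu : u ∈ Vc) (huw : (contiguity N).Adj u w)
    (hp : p.IsPath) (hq : q.IsPath) (hup : u ∉ p.support) (huq : u ∉ q.support)
    (hb : b ∈ V) (hd : d ∈ V) (hpV : ∀ x ∈ p.support, x ∈ Vc ∧ (x ∈ V → x = b))
    (hqV : ∀ x ∈ q.support, x ∈ Vc ∧ (x ∈ V → x = d)) : b = d := by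
  induction p generalizing u with
  | nil => exact (hqV _ q.start_mem_support).2 hb
  | @cons w x b h p ih =>
    rw [SimpleGraph.Walk.cons_isPath_iff] at hp
    have hwV : w ∉ V := fun hw =>
      hp.2 (((hpV w (by simp)).2 hw) ▸ p.end_mem_support)
    cases q with
    | nil => exact absurd hd hwV
    | @cons _ y _ h' q =>
      rw [SimpleGraph.Walk.cons_isPath_iff] at hq
      simp only [SimpleGraph.Walk.support_cons, List.mem_cons, not_or] at hup huq hpV hqV
      have hx := (hpV x (Or.inr p.start_mem_support)).1
      have hy := (hqV y (Or.inr q.start_mem_support)).1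
      have hxu : x ≠ u := fun h => hup.2 (h ▸ p.start_mem_support)
      have hyu : y ≠ u := fun h => huq.2 (h ▸ q.start_mem_support)
      have hcard := hsimple w (hpV w (Or.inl rfl)).1 hwV
      -- Otherwise the insertion `w` would have the three legs `u`, `x`, `y`.
      have hxy : x = y := by
        by_contra hne
        have hsub : (({u, x, y} : Finset (Vertex N)) : Set (Vertex N)) ⊆
            {d | d ∈ Vc ∧ (contiguity N).Adj w d} := by
          intro z hz
          simp only [coe_insert, coe_singleton, Set.mem_insert_iff, Set.mem_singleton_iff] at hz
          rcases hz with rfl | rfl | rfl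
          exacts [⟨hu, huw.symm⟩, ⟨hx, h⟩, ⟨hy, h'⟩]
        have := Set.ncard_le_ncard hsub (Set.toFinite _)
        rw [hcard, Set.ncard_coe_finset, card_eq_three.2 ⟨u, x, y, hxu.symm, hyu.symm, hne, rfl⟩]
          at this
        omega
      subst hxy
      exact ih q (hpV w (Or.inl rfl)).1 h hp.1 hq.1 hp.2 hq.2 hb
        (fun z hz => hpV z (Or.inr hz)) fun z hz => hqV z (Or.inr hz)

/-- Two links have disjoint sets of indices. -/
theorem IsLink.eq_of_ne {V Vc : Finset (Vertex N)} (hproper : IsProper Vc)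
    (hsimple : IsSimple V Vc) {a b d e : Vertex N} (h₁ : IsLink V Vc a b) (h₂ : IsLink V Vc d e)
    {j : Fin N} (hj₁ : a j ≠ b j) (hj₂ : d j ≠ e j) : s(a, b) = s(d, e) := by
  obtain ⟨ha, hb, -, p, hp, hpV⟩ := h₁
  obtain ⟨hd, he, -, q, hq, hqV⟩ := h₂
  obtain ⟨u, w, p₁, p₂, huw, hne, hp₁, hp₂, hwp, hup, hs₁, hs₂⟩ := exists_adj_of_ne p hp hj₁
  obtain ⟨x, y, q₁, q₂, hxy, hne', hq₁, hq₂, hyq, hxq, ht₁, ht₂⟩ := exists_adj_of_ne q hq hj₂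
  have hp₁V : ∀ z ∈ p₁.support, z ∈ Vc ∧ (z ∈ V → z = a) := fun z hz =>
    ⟨(hpV z (hs₁ z hz).1).1, fun h => ((hpV z (hs₁ z hz).1).2 h).resolve_right (hs₁ z hz).2⟩
  have hp₂V : ∀ z ∈ p₂.support, z ∈ Vc ∧ (z ∈ V → z = b) := fun z hz =>
    ⟨(hpV z (hs₂ z hz).1).1, fun h => ((hpV z (hs₂ z hz).1).2 h).resolve_left (hs₂ z hz).2⟩
  have hq₁V : ∀ z ∈ q₁.support, z ∈ Vc ∧ (z ∈ V → z = d) := fun z hz =>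
    ⟨(hqV z (ht₁ z hz).1).1, fun h => ((hqV z (ht₁ z hz).1).2 h).resolve_right (ht₁ z hz).2⟩
  have hq₂V : ∀ z ∈ q₂.support, z ∈ Vc ∧ (z ∈ V → z = e) := fun z hz =>
    ⟨(hqV z (ht₂ z hz).1).1, fun h => ((hqV z (ht₂ z hz).1).2 h).resolve_left (ht₂ z hz).2⟩
  have huV := (hp₁V u p₁.start_mem_support).1
  have hwV := (hp₂V w p₂.start_mem_support).1
  have hxV := (hq₁V x q₁.start_mem_support).1
  have hyV := (hq₂V y q₂.start_mem_support).1
  -- Both paths use the same edge by properness. Following it through insertions in both directions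
  -- leads to the same two ends, up to the orientation of the edge.
  have heq := hproper u huV w hwV x hxV y hyV huw hxy j hne hne'
  rcases Sym2.eq_iff.1 heq with ⟨rfl, rfl⟩ | ⟨rfl, rfl⟩
  · rw [end_eq_of_common_adj hsimple p₂ q₂ huV huw hp₂ hq₂ hup hxq hb he hp₂V hq₂V,
      end_eq_of_common_adj hsimple p₁ q₁ hwV huw.symm hp₁ hq₁ hwp hyq ha hd hp₁V hq₁V]
  · rw [end_eq_of_common_adj hsimple p₂ q₁ huV huw hp₂ hq₁ hup hyq hb hd hp₂V hq₁V,
      end_eq_of_common_adj hsimple p₁ q₂ hwV huw.symm hp₁ hq₂ hwp hxq ha he hp₁V hq₂V]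
    exact Sym2.eq_swap

/-- A walk in `Vc` from `W` to `V \ W` contains a link from `W` to `V \ W`. -/
theorem exists_walk_crossing {V Vc W : Finset (Vertex N)} {a b : Vertex N}
    (p : (contiguity N).Walk a b) (hpVc : ∀ x ∈ p.support, x ∈ Vc) (hb : b ∈ V) (hbW : b ∉ W) :
    (∃ b' ∈ V, b' ∉ W ∧ ∃ q : (contiguity N).Walk a b',
      ∀ x ∈ q.support, x ∈ Vc ∧ (x ∈ V → x = a ∨ x = b')) ∨
    ∃ c ∈ W, c ∈ V ∧ ∃ b' ∈ V, b' ∉ W ∧ ∃ q : (contiguity N).Walk c b',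
      ∀ x ∈ q.support, x ∈ Vc ∧ (x ∈ V → x = c ∨ x = b') := by
  -- The first alternative is a link whose beginning may still be missing: it is prolonged backwards
  -- through insertions. In the second, the link is complete and is carried along.
  induction p with
  | @nil a => exact Or.inl ⟨a, hb, hbW, .nil, by simpa using hpVc⟩
  | @cons a x b h p ih =>
    simp only [SimpleGraph.Walk.support_cons, List.mem_cons] at hpVc
    rcases ih (fun z hz => hpVc z (Or.inr hz)) hb hbW with ⟨b', hb', hbW', q, hq⟩ | h'
    · by_cases hxV : x ∈ V
      · by_cases hxW : x ∈ W
        · exact Or.inr ⟨x, hxW, hxV, b', hb', hbW', q, hq⟩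
        · refine Or.inl ⟨x, hxV, hxW, .cons h .nil, ?_⟩
          intro z hz
          simp only [SimpleGraph.Walk.support_cons, SimpleGraph.Walk.support_nil, List.mem_cons,
            List.not_mem_nil, or_false] at hz
          rcases hz with rfl | rfl
          · exact ⟨hpVc _ (Or.inl rfl), fun _ => Or.inl rfl⟩
          · exact ⟨hpVc _ (Or.inr p.start_mem_support), fun _ => Or.inr rfl⟩
      · refine Or.inl ⟨b', hb', hbW', .cons h q, ?_⟩
        intro z hz
        simp only [SimpleGraph.Walk.support_cons, List.mem_cons] at hz
        rcases hz with rfl | hz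
        · exact ⟨hpVc _ (Or.inl rfl), fun _ => Or.inl rfl⟩
        · refine ⟨(hq z hz).1, fun hzV => ?_⟩
          rcases (hq z hz).2 hzV with rfl | h''
          · exact absurd hzV hxV
          · exact Or.inr h''
    · exact Or.inr h'

/-- The links connect the vertices of `V`. -/
theorem exists_isLink_crossing {V Vc W : Finset (Vertex N)} (hV : V ⊆ Vc)
    (hconn : (graph Vc).Connected) (hWV : W ⊆ V) {a b : Vertex N} (ha : a ∈ W) (hb : b ∈ V)
    (hbW : b ∉ W) : ∃ c ∈ W, ∃ b' ∈ V, b' ∉ W ∧ IsLink V Vc c b' := by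
  obtain ⟨p⟩ := hconn.preconnected ⟨a, hV (hWV ha)⟩ ⟨b, hV hb⟩
  let f : graph Vc →g contiguity N := ⟨Subtype.val, fun h => h⟩
  have hp : ∀ x ∈ (p.map f).support, x ∈ Vc := by
    intro x hx
    rw [SimpleGraph.Walk.support_map, List.mem_map] at hx
    obtain ⟨y, -, rfl⟩ := hx
    exact y.2
  have key : ∃ c ∈ W, c ∈ V ∧ ∃ b' ∈ V, b' ∉ W ∧ ∃ q : (contiguity N).Walk c b',
      ∀ x ∈ q.support, x ∈ Vc ∧ (x ∈ V → x = c ∨ x = b') := by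
    rcases exists_walk_crossing (p.map f) hp hb hbW with h | h
    · exact ⟨a, ha, hWV ha, h⟩
    · exact h
  obtain ⟨c, hc, hcV, b', hb', hbW', q, hq⟩ := key
  exact ⟨c, hc, b', hb', hbW', hcV, hb', fun h => hbW' (h ▸ hc), q.bypass, q.bypass_isPath,
    fun x hx => hq x (q.support_bypass_subset_support hx)⟩

/-- The vertices cannot all be insertions. -/
theorem nonempty_of_isSimple {V Vc : Finset (Vertex N)} (hconn : (graph Vc).Connected)
    (hproper : IsProper Vc) (hsimple : IsSimple V Vc) : V.Nonempty := by
  classical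
  by_contra hne
  rw [not_nonempty_iff_eq_empty] at hne
  subst hne
  -- With no vertices in `V`, every vertex of `Vc` has degree 2. But each edge is a bridge: by
  -- properness, deleting the edge of index `j` freezes the `j`-th variable along walks. So the
  -- graph is a nontrivial tree and has a leaf, a contradiction.
  have hacyc : (graph Vc).IsAcyclic := by
    rw [SimpleGraph.isAcyclic_iff_forall_adj_isBridge]
    intro u w huw
    obtain ⟨j, hj, -⟩ := id huw
    rw [SimpleGraph.isBridge_iff]
    rintro ⟨p⟩
    have : ∀ {x y : {a // a ∈ Vc}} (_ : ((graph Vc).deleteEdges {s(u, w)}).Walk x y),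
        x.1 j = y.1 j := by
      intro x y p
      induction p with
      | nil => rfl
      | @cons x y z h p ih =>
        rw [← ih]
        by_contra hxy
        rw [SimpleGraph.deleteEdges_adj] at h
        refine h.2 ?_
        have := hproper x x.2 y y.2 u u.2 w w.2 h.1 huw j hxy hj
        simp only [Set.mem_singleton_iff, Sym2.eq_iff, Subtype.ext_iff] at this ⊢
        exact this
    exact hj (this p)
  have hdeg : ∀ v, (graph Vc).degree v = 2 := by
    intro v
    rw [← hsimple v.1 v.2 (notMem_empty _), ← SimpleGraph.card_neighborFinset_eq_degree,
      ← Set.ncard_coe_finset, ← Set.ncard_image_of_injective _ Subtype.val_injective]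
    congr 1
    ext x
    simp only [SimpleGraph.coe_neighborFinset, Set.mem_image, SimpleGraph.mem_neighborSet,
      Set.mem_ofPred_eq]
    exact ⟨fun ⟨y, hy, h⟩ => h ▸ ⟨y.2, hy⟩, fun h => ⟨⟨x, h.1⟩, h.2, rfl⟩⟩
  have hnt : Nontrivial {a // a ∈ Vc} := by
    obtain ⟨v⟩ := hconn.nonempty
    have : 0 < (graph Vc).degree v := by rw [hdeg]; norm_num
    rw [SimpleGraph.degree_pos_iff_exists_adj] at this
    obtain ⟨w, hw⟩ := this
    exact ⟨v, w, hw.ne⟩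
  obtain ⟨v, hv⟩ := SimpleGraph.IsTree.exists_vert_degree_one_of_nontrivial ⟨hconn, hacyc⟩
  rw [hdeg] at hv
  omega

/-- Extending the part `W` of a junction tree by one vertex. -/
theorem exists_junctionTree_insert {V Vc W : Finset (Vertex N)}
    {L : Finset (Vertex N × Vertex N)} (hV : V ⊆ Vc) (hconn : (graph Vc).Connected)
    (hproper : IsProper Vc) (hsimple : IsSimple V Vc) (hL : IsLinkList V Vc L) {a : Vertex N}
    (hWV : W ⊂ V) (hW : JunctionTree a W (L.filter fun l => l.1 ∈ W ∧ l.2 ∈ W))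
    (hagree : ∀ b ∈ V, b ∉ W → ∀ c ∈ V, IsLink V Vc b c → ∀ j, b j ≠ c j →
      ∀ d ∈ W, ∀ e ∈ W, d j = e j) :
    ∃ b ∈ V, b ∉ W ∧
      JunctionTree a (insert b W)
        (L.filter fun l => l.1 ∈ insert b W ∧ l.2 ∈ insert b W) ∧
      (∀ b' ∈ V, b' ∉ insert b W → ∀ c ∈ V, IsLink V Vc b' c → ∀ j, b' j ≠ c j →
        ∀ d ∈ insert b W, ∀ e ∈ insert b W, d j = e j) := by
  obtain ⟨b₀, hb₀, hb₀W⟩ := exists_of_ssubset hWV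
  obtain ⟨c, hc, b, hb, hbW, hlink⟩ :=
    exists_isLink_crossing hV hconn hWV.1 hW.root_mem hb₀ hb₀W
  have hcV := hWV.1 hc
  -- At an index `j` of the link from `c` to `b`, all of `W` agrees with `c`. So a link from `d` to
  -- `b` shares this index and must be the same link.
  have huniq : ∀ d ∈ W, IsLink V Vc d b → d = c := by
    intro d hd hdb
    obtain ⟨j, hj⟩ := Function.ne_iff.1 hlink.2.2.1
    have hdc := hagree b hb hbW c hcV hlink.symm j hj.symm d hd c hc
    have := hdb.eq_of_ne hproper hsimple hlink (j := j) (by rw [hdc]; exact hj) hj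
    rcases Sym2.eq_iff.1 this with h | h
    · exact h.1
    · exact absurd hd (h.1 ▸ hbW)
  refine ⟨b, hb, hbW, ?_, ?_⟩
  · have : ∃ l, (l = (b, c) ∨ l = (c, b)) ∧ l ∈ L := by
      rcases hL.complete c b hlink with h | h
      exacts [⟨_, Or.inr rfl, h⟩, ⟨_, Or.inl rfl, h⟩]
    obtain ⟨l, hl, hlL⟩ := this
    have hfilter : (L.filter fun l => l.1 ∈ insert b W ∧ l.2 ∈ insert b W) =
        insert l (L.filter fun l => l.1 ∈ W ∧ l.2 ∈ W) := by
      ext ⟨x, y⟩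
      simp only [mem_filter, mem_insert]
      constructor
      · rintro ⟨hxy, hx, hy⟩
        have hlk := hL.isLink x y hxy
        rcases hx with rfl | hx
        · rcases hy with rfl | hy
          · exact absurd rfl hlk.2.2.1
          · obtain rfl := huniq y hy hlk.symm
            rcases hl with rfl | rfl
            · exact Or.inl rfl
            · exact absurd hlL (hL.once _ _ hxy)
        · rcases hy with rfl | hy
          · obtain rfl := huniq x hx hlk
            rcases hl with rfl | rfl
            · exact absurd hlL (hL.once _ _ hxy)
            · exact Or.inl rfl
          · exact Or.inr ⟨hxy, hx, hy⟩
      · rintro (rfl | ⟨hxy, hx, hy⟩)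
        · rcases hl with h | h <;> cases h
          · exact ⟨hlL, Or.inl rfl, Or.inr hc⟩
          · exact ⟨hlL, Or.inr hc, Or.inl rfl⟩
        · exact ⟨hxy, Or.inr hx, Or.inr hy⟩
    rw [hfilter]
    refine hW.step hc hbW hl ?_ ?_
    · rw [mem_filter]
      rintro ⟨-, h₁, h₂⟩
      rcases hl with rfl | rfl
      exacts [hbW h₁, hbW h₂]
    · intro d hd j hdb
      by_contra hcb
      exact hcb (hdb ▸ (hagree b hb hbW c hcV hlink.symm j (Ne.symm hcb) d hd c hc).symm)
  · intro b' hb' hb'W e he hlink' j hj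
    simp only [mem_insert, not_or] at hb'W
    have hold := hagree b' hb' hb'W.2 e he hlink' j hj
    -- The new vertex can spoil the agreement at `j` only if `j` is an index of its link to `c`;
    -- then the two links coincide, although `b'` is neither `b` nor in `W`.
    have hbc : b j = c j := by
      by_contra hne
      have := hlink'.eq_of_ne hproper hsimple hlink.symm hj hne
      rcases Sym2.eq_iff.1 this with h | h
      · exact hb'W.1 h.1
      · exact hb'W.2 (h.1 ▸ hc)
    intro x hx y hy
    rcases mem_insert.1 hx with hx | hx <;> rcases mem_insert.1 hy with hy | hy
    · rw [hx, hy]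
    · rw [hx, hbc]; exact hold c hc y hy
    · rw [hy, hbc]; exact hold x hx c hc
    · exact hold x hx y hy

/-- The vertices of `V` and the links form a junction tree with an arbitrary root. -/
theorem junctionTree_of_isLinkList {V Vc : Finset (Vertex N)} {L : Finset (Vertex N × Vertex N)}
    (hV : V ⊆ Vc) (hconn : (graph Vc).Connected) (hproper : IsProper Vc)
    (hsimple : IsSimple V Vc) (hL : IsLinkList V Vc L) {a : Vertex N} (ha : a ∈ V) :
    JunctionTree a V L := by
  -- The last clause is the invariant that drives the growth of `W`: a link not contained in `W`
  -- changes only variables on which `W` is constant.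
  have key : ∀ n, n + 1 ≤ V.card → ∃ W ⊆ V, W.card = n + 1 ∧
      JunctionTree a W (L.filter fun l => l.1 ∈ W ∧ l.2 ∈ W) ∧
      (∀ b ∈ V, b ∉ W → ∀ c ∈ V, IsLink V Vc b c → ∀ j, b j ≠ c j →
        ∀ d ∈ W, ∀ e ∈ W, d j = e j) := by
    intro n
    induction n with
    | zero =>
      intro _
      refine ⟨{a}, by simpa using ha, by simp, ?_, ?_⟩
      · have : (L.filter fun l => l.1 ∈ ({a} : Finset (Vertex N)) ∧ l.2 ∈ ({a} : Finset _)) = ∅ := by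
          refine filter_eq_empty_iff.2 fun {l} hl h => ?_
          simp only [mem_singleton] at h
          exact (hL.isLink l.1 l.2 hl).2.2.1 (h.1.trans h.2.symm)
        rw [this]
        exact .root
      · simp
    | succ n ih =>
      intro hn
      obtain ⟨W, hWV, hcard, hW, hagree⟩ := ih (by omega)
      have hss : W ⊂ V := ⟨hWV, fun h => by have := card_le_card h; omega⟩
      obtain ⟨b, hb, hbW, hJ, hagree'⟩ :=
        exists_junctionTree_insert hV hconn hproper hsimple hL hss hW hagree
      exact ⟨insert b W, insert_subset hb hWV, by rw [card_insert_of_notMem hbW, hcard], hJ,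
        hagree'⟩
  have hpos : 0 < V.card := card_pos.2 ⟨a, ha⟩
  obtain ⟨W, hWV, hcard, hW, -⟩ := key (V.card - 1) (by omega)
  obtain rfl := eq_of_subset_of_card_le hWV (by omega)
  have : (L.filter fun l => l.1 ∈ W ∧ l.2 ∈ W) = L := by
    refine filter_true_of_mem fun l hl => ?_
    have := hL.isLink l.1 l.2 hl
    exact ⟨this.1, this.2.1⟩
  rwa [this] at hW

end Combinatorics

/-! ### Partial integrals: Fubini, null sets, and detection of functions by their marginals. -/

noncomputable section PartialIntegrals

open Function

variable {N : ℕ} {ν : Fin N × Bool → Measure ℝ}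

theorem updateFinset_eq_of_notMem {ι : Type*} [DecidableEq ι] {S : Finset ι} (z : ι → ℝ)
    (y : S → ℝ) {i : ι} (hi : i ∉ S) : updateFinset z S y i = z i := by
  simp [updateFinset, hi]

theorem _root_.DependsOn.updateFinset_eq {ι α : Type*} [DecidableEq ι] {k : (ι → ℝ) → α}
    {s S : Finset ι} (hk : DependsOn k (s : Set ι)) (hs : Disjoint s S) (z : ι → ℝ) (y : S → ℝ) :
    k (updateFinset z S y) = k z :=
  hk fun _ hi => updateFinset_eq_of_notMem z y (Finset.disjoint_left.1 hs hi)

theorem _root_.DependsOn.mul {ι α : Type*} [Mul α] {f g : (ι → ℝ) → α} {s : Set ι}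
    (hf : DependsOn f s) (hg : DependsOn g s) : DependsOn (fun z => f z * g z) s := by
  intro x y h
  simp only
  rw [hf h, hg h]

theorem _root_.DependsOn.comp_left {ι α β : Type*} {f : (ι → ℝ) → α} {s : Set ι}
    (hf : DependsOn f s) (g : α → β) : DependsOn (fun z => g (f z)) s := by
  intro x y h
  simp only
  rw [hf h]

/-- Phase space as the product of the space of the variables not in `S` and the space of the
variables in `S`. -/
def splitEquiv (S : Finset (Fin N × Bool)) :
    Phase N ≃ᵐ ({i // i ∉ S} → ℝ) × (S → ℝ) :=
  (MeasurableEquiv.piEquivPiSubtypeProd (fun _ => ℝ) (· ∈ S)).trans MeasurableEquiv.prodComm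

theorem splitEquiv_apply (S : Finset (Fin N × Bool)) (z : Phase N) :
    splitEquiv S z = (fun i : {i // i ∉ S} => z i, fun i : S => z i) := rfl

theorem splitEquiv_symm_apply (S : Finset (Fin N × Bool)) (z : Phase N) (y : S → ℝ) :
    (splitEquiv S).symm ((splitEquiv S z).1, y) = updateFinset z S y := by
  rw [MeasurableEquiv.symm_apply_eq]
  simp only [splitEquiv_apply, Prod.mk.injEq]
  refine ⟨funext fun i => ?_, funext fun i => ?_⟩
  · simp [updateFinset, i.2]
  · simp [updateFinset]

theorem dependsOn_integrate {f : Phase N → ℝ} {s : Finset (Fin N × Bool)}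
    (hf : DependsOn f (s : Set (Fin N × Bool))) (S : Finset (Fin N × Bool)) :
    DependsOn (integrate ν S f) ((s \ S : Finset _) : Set (Fin N × Bool)) := by
  intro x y h
  unfold integrate
  congr 1
  ext w
  refine hf.updateFinset w fun i hi => h i ?_
  simpa using hi

theorem dependsOn_lmarginal {f : Phase N → ENNReal} {s : Finset (Fin N × Bool)}
    (hf : DependsOn f (s : Set (Fin N × Bool))) (S : Finset (Fin N × Bool)) :
    DependsOn (lmarginal ν S f) ((s \ S : Finset _) : Set (Fin N × Bool)) := by
  intro x y h
  unfold lmarginal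
  congr 1
  ext w
  refine hf.updateFinset w fun i hi => h i ?_
  simpa using hi

theorem integrate_mul_left {k f : Phase N → ℝ} {s S : Finset (Fin N × Bool)}
    (hk : DependsOn k (s : Set (Fin N × Bool))) (hs : Disjoint s S) (z : Phase N) :
    integrate ν S (fun w => k w * f w) z = k z * integrate ν S f z := by
  simp only [integrate, hk.updateFinset_eq hs, integral_const_mul]

theorem lmarginal_mul_left {k f : Phase N → ENNReal} {s S : Finset (Fin N × Bool)}
    (hk : DependsOn k (s : Set (Fin N × Bool))) (hs : Disjoint s S) (hf : Measurable f)
    (z : Phase N) :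
    lmarginal ν S (fun w => k w * f w) z = k z * lmarginal ν S f z := by
  simp only [lmarginal, hk.updateFinset_eq hs]
  exact lintegral_const_mul _ (hf.comp measurable_updateFinset)

/-- No finiteness is needed: where the integral diverges, both sides take the default value 0. -/
theorem integrate_eq_toReal_lmarginal {f : Phase N → ℝ} (hf : Measurable f) (h : ∀ z, 0 ≤ f z)
    (S : Finset (Fin N × Bool)) (z : Phase N) :
    integrate ν S f z = (lmarginal ν S (fun w => ENNReal.ofReal (f w)) z).toReal :=
  integral_eq_lintegral_of_nonneg_ae (.of_forall fun _ => h _)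
    (hf.comp measurable_updateFinset).aestronglyMeasurable

theorem lmarginal_eq_ofReal_integrate {f : Phase N → ℝ} (hf : Measurable f) (h : ∀ z, 0 ≤ f z)
    {S : Finset (Fin N × Bool)} {z : Phase N}
    (hz : lmarginal ν S (fun w => ENNReal.ofReal (f w)) z ≠ ⊤) :
    lmarginal ν S (fun w => ENNReal.ofReal (f w)) z = ENNReal.ofReal (integrate ν S f z) := by
  rw [integrate_eq_toReal_lmarginal hf h, ENNReal.ofReal_toReal hz]

variable [∀ i, SigmaFinite (ν i)]

theorem measurePreserving_splitEquiv (S : Finset (Fin N × Bool)) :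
    MeasurePreserving (splitEquiv S) (Measure.pi ν)
      ((Measure.pi fun i : {i // i ∉ S} => ν i).prod (Measure.pi fun i : S => ν i)) := by
  refine Measure.measurePreserving_swap.comp ?_
  convert measurePreserving_piEquivPiSubtypeProd ν (· ∈ S)
  rfl

theorem ae_splitEquiv_fst {S : Finset (Fin N × Bool)} {p : ({i // i ∉ S} → ℝ) → Prop}
    (h : ∀ᵐ x ∂Measure.pi fun i : {i // i ∉ S} => ν i, p x) :
    ∀ᵐ z ∂Measure.pi ν, p (splitEquiv S z).1 :=
  (measurePreserving_splitEquiv S).quasiMeasurePreserving.ae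
    (Measure.quasiMeasurePreserving_fst.ae h)

/-- A null set meets almost every fibre in a null set; this makes partial integration well defined
on a.e. classes. -/
theorem ae_ae_updateFinset {p : Phase N → Prop} (h : ∀ᵐ z ∂Measure.pi ν, p z)
    (S : Finset (Fin N × Bool)) :
    ∀ᵐ z ∂Measure.pi ν, ∀ᵐ y ∂Measure.pi fun i : S => ν i, p (updateFinset z S y) := by
  have h' := Measure.ae_ae_of_ae_prod
    ((measurePreserving_splitEquiv (ν := ν) S).symm.quasiMeasurePreserving.ae h)
  simpa only [splitEquiv_symm_apply] using ae_splitEquiv_fst h'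

theorem ae_integrable_updateFinset {f : Phase N → ℝ} (hf : Integrable f (Measure.pi ν))
    (S : Finset (Fin N × Bool)) :
    ∀ᵐ z ∂Measure.pi ν,
      Integrable (fun y => f (updateFinset z S y)) (Measure.pi fun i : S => ν i) := by
  have h := ((measurePreserving_splitEquiv (ν := ν) S).symm.integrable_comp_of_integrable
    hf).prod_right_ae
  simpa only [Function.comp_def, splitEquiv_symm_apply] using ae_splitEquiv_fst h

theorem integrate_congr_ae {f g : Phase N → ℝ} (h : f =ᵐ[Measure.pi ν] g)
    (S : Finset (Fin N × Bool)) : integrate ν S f =ᵐ[Measure.pi ν] integrate ν S g := by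
  filter_upwards [ae_ae_updateFinset h S] with z hz
  exact integral_congr_ae hz

theorem lmarginal_congr_ae {f g : Phase N → ENNReal} (h : f =ᵐ[Measure.pi ν] g)
    (S : Finset (Fin N × Bool)) : lmarginal ν S f =ᵐ[Measure.pi ν] lmarginal ν S g := by
  filter_upwards [ae_ae_updateFinset h S] with z hz
  exact lintegral_congr_ae hz

theorem measurable_integrate {f : Phase N → ℝ} (hf : Measurable f) (S : Finset (Fin N × Bool)) :
    Measurable (integrate ν S f) := by
  have : StronglyMeasurable (Function.uncurry fun (z : Phase N) (y : S → ℝ) =>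
      f (updateFinset z S y)) := (hf.comp measurable_updateFinset').stronglyMeasurable
  exact this.integral_prod_right.measurable

/-- Fubini on each fibre along which `f` is integrable, that is, on almost every one. -/
theorem integrate_union {f : Phase N → ℝ} (hf : Integrable f (Measure.pi ν))
    {S T : Finset (Fin N × Bool)} (hST : Disjoint S T) :
    integrate ν (S ∪ T) f =ᵐ[Measure.pi ν] integrate ν S (integrate ν T f) := by
  filter_upwards [ae_integrable_updateFinset hf (S ∪ T)] with z hz
  have hmp := measurePreserving_piFinsetUnion hST ν
  have := integral_prod _ (hmp.integrable_comp_of_integrable hz)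
  refine (hmp.integral_comp' _).symm.trans (this.trans ?_)
  simp only [integrate, updateFinset_updateFinset hST]
  rfl

theorem lmarginal_comm (f : Phase N → ENNReal) (hf : Measurable f) (S : Finset (Fin N × Bool))
    (z : Phase N) : ∫⁻ w, f w ∂Measure.pi ν = lmarginal ν Sᶜ (lmarginal ν S f) z := by
  rw [lintegral_eq_lmarginal_univ z, ← lmarginal_union ν f hf disjoint_compl_left,
    union_comm, union_compl]

theorem ae_eq_zero_of_lmarginal_eq_zero {f : Phase N → ENNReal} (hf : Measurable f)
    {S : Finset (Fin N × Bool)} (h : ∀ z, lmarginal ν S f z = 0) : f =ᵐ[Measure.pi ν] 0 := by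
  rw [← lintegral_eq_zero_iff hf, lmarginal_comm f hf S 0]
  have : lmarginal ν S f = fun _ => 0 := funext h
  rw [this]
  simp [lmarginal]

/-- The set where the marginal vanishes does not involve the variables in `S`, so its indicator can
be pulled out of the partial integral. Multiplying by it makes the marginal vanish everywhere, at
the cost of a null set. -/
theorem ae_eq_zero_of_lmarginal_ae_eq_zero {f : Phase N → ENNReal} (hf : Measurable f)
    {S : Finset (Fin N × Bool)} (h : lmarginal ν S f =ᵐ[Measure.pi ν] 0) :
    f =ᵐ[Measure.pi ν] 0 := by
  have hB : MeasurableSet {z | lmarginal ν S f z = 0} :=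
    (hf.lmarginal ν) (measurableSet_singleton 0)
  have hk : DependsOn ({z | lmarginal ν S f z = 0}.indicator fun _ => (1 : ENNReal))
      ((Sᶜ : Finset _) : Set (Fin N × Bool)) := by
    have := dependsOn_lmarginal (ν := ν) (s := univ) (f := f) (by simpa using dependsOn_univ f) S
    have := this.comp_left fun t : ENNReal => if t = 0 then (1 : ENNReal) else 0
    rw [← compl_eq_univ_sdiff] at this
    convert this using 2
    simp [Set.indicator_apply]
  have := ae_eq_zero_of_lmarginal_eq_zero (ν := ν) (S := S)
    ((measurable_const.indicator hB).mul hf) (fun z => by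
      refine (lmarginal_mul_left hk disjoint_compl_left hf z).trans ?_
      by_cases hz : lmarginal ν S f z = 0 <;> simp [hz])
  filter_upwards [h, this] with z hz hz'
  simpa [hz] using hz'

theorem ae_lt_top_of_lmarginal_lt_top {f : Phase N → ENNReal} (hf : Measurable f)
    {S : Finset (Fin N × Bool)} (h : ∀ z, lmarginal ν S f z < ⊤) :
    ∀ᵐ z ∂Measure.pi ν, f z < ⊤ := by
  have hB : MeasurableSet {z | f z = ⊤} := hf (measurableSet_singleton ⊤)
  have := ae_eq_zero_of_lmarginal_eq_zero (ν := ν) (S := S)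
    ((measurable_const (a := (1 : ENNReal))).indicator hB) (fun z => by
      have h1 := ae_lt_top (hf.comp (measurable_updateFinset (x := z) (s := S))) (h z).ne
      refine (lintegral_eq_zero_iff
        ((measurable_const.indicator hB).comp measurable_updateFinset)).2 ?_
      filter_upwards [h1] with y hy
      simpa using hy.ne)
  filter_upwards [this] with z hz
  rw [lt_top_iff_ne_top]
  intro h'
  simp [h'] at hz

/-- A function whose partial integral vanishes vanishes itself, if it is not negative. -/
theorem ae_eq_zero_of_integrate_eq_zero {f k r : Phase N → ℝ} (hf : Integrable f (Measure.pi ν))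
    (hf₀ : ∀ᵐ z ∂Measure.pi ν, 0 ≤ f z) {S : Finset (Fin N × Bool)}
    (hr : integrate ν S f =ᵐ[Measure.pi ν] r) (hk : Measurable k)
    (hkS : DependsOn k ((Sᶜ : Finset _) : Set (Fin N × Bool)))
    (h : ∀ᵐ z ∂Measure.pi ν, k z = 0 → r z = 0) :
    ∀ᵐ z ∂Measure.pi ν, k z = 0 → f z = 0 := by
  obtain ⟨g, hg, hfg⟩ := hf.aestronglyMeasurable
  have hB : MeasurableSet {z | k z = 0} := hk (measurableSet_singleton 0)
  have hind : DependsOn ({z | k z = 0}.indicator fun _ => (1 : ENNReal))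
      ((Sᶜ : Finset _) : Set (Fin N × Bool)) :=
    hkS.comp_left fun t : ℝ => if t = 0 then (1 : ENNReal) else 0
  have hgm : Measurable fun z => ENNReal.ofReal (g z) := hg.measurable.ennreal_ofReal
  -- The condition `k z = 0` is constant along the fibres, so `f` can be cut off to it under the
  -- partial integral; `g` is a strictly measurable version of `f`.
  have key : lmarginal ν S (fun z => ({z | k z = 0}.indicator fun _ => (1 : ENNReal)) z *
      ENNReal.ofReal (g z)) =ᵐ[Measure.pi ν] 0 := by
    filter_upwards [h, hr, ae_integrable_updateFinset hf S, ae_ae_updateFinset hfg S,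
      ae_ae_updateFinset hf₀ S] with z hz hrz hint hfgz hz₀
    rw [lmarginal_mul_left hind disjoint_compl_left hgm]
    by_cases hkz : k z = 0
    · have h0 : ∫ y, f (updateFinset z S y) ∂Measure.pi (fun i : S => ν i) = 0 := by
        rw [← hz hkz, ← hrz]; rfl
      rw [integral_eq_zero_iff_of_nonneg_ae hz₀ hint] at h0
      have : lmarginal ν S (fun z => ENNReal.ofReal (g z)) z = 0 := by
        refine (lintegral_eq_zero_iff (hgm.comp measurable_updateFinset)).2 ?_
        filter_upwards [h0, hfgz] with y hy hy'
        simp only [Function.comp_apply, ← hy', hy, Pi.zero_apply, ENNReal.ofReal_zero]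
      rw [this, mul_zero]
      rfl
    · simp [hkz]
  filter_upwards [ae_eq_zero_of_lmarginal_ae_eq_zero ((measurable_const.indicator hB).mul hgm) key,
    hfg, hf₀] with z hz hfgz hz₀ hkz
  refine le_antisymm ?_ hz₀
  simpa [hkz, hfgz] using hz

/-- Two functions with the same integrals over all sets of the form `{X ∈ B}`, where `X` are the
variables not in `S`, have the same partial integral over the variables in `S`. -/
theorem integrate_ae_eq_of_setIntegral_eq {f g : Phase N → ℝ} (hf : Integrable f (Measure.pi ν))
    (hg : Integrable g (Measure.pi ν)) {S : Finset (Fin N × Bool)}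
    (h : ∀ A, MeasurableSet[Filtration.piFinset (X := fun _ => ℝ) Sᶜ] A →
      ∫ z in A, f z ∂Measure.pi ν = ∫ z in A, g z ∂Measure.pi ν) :
    integrate ν S f =ᵐ[Measure.pi ν] integrate ν S g := by
  have hmp := measurePreserving_splitEquiv (ν := ν) S
  have hf' := hmp.symm.integrable_comp_of_integrable hf
  have hg' := hmp.symm.integrable_comp_of_integrable hg
  have hset : ∀ (f : Phase N → ℝ) (B : Set ({i // i ∉ S} → ℝ)), Integrable f (Measure.pi ν) →
      MeasurableSet B → ∫ x in B, ∫ y, (f ∘ (splitEquiv S).symm) (x, y)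
        ∂(Measure.pi fun i : S => ν i) ∂(Measure.pi fun i : {i // i ∉ S} => ν i) =
      ∫ z in (fun z : Phase N => (splitEquiv S z).1) ⁻¹' B, f z ∂Measure.pi ν := by
    intro f B hf hB
    have h1 := setIntegral_prod (μ := Measure.pi fun i : {i // i ∉ S} => ν i)
      (ν := Measure.pi fun i : S => ν i) (f ∘ (splitEquiv S).symm) (s := B) (t := Set.univ)
      (hmp.symm.integrable_comp_of_integrable hf).integrableOn
    simp only [Measure.restrict_univ] at h1
    rw [← h1, ← hmp.setIntegral_preimage_emb (splitEquiv S).measurableEmbedding]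
    simp only [Function.comp_apply, MeasurableEquiv.symm_apply_apply]
    congr 2
    ext z
    simp
  have key : (fun x => ∫ y, (f ∘ (splitEquiv S).symm) (x, y) ∂(Measure.pi fun i : S => ν i))
      =ᵐ[Measure.pi fun i : {i // i ∉ S} => ν i]
      fun x => ∫ y, (g ∘ (splitEquiv S).symm) (x, y) ∂(Measure.pi fun i : S => ν i) := by
    -- Both partial integrals are integrable functions of the kept variables, determined by their
    -- integrals over sets `B`; these are integrals of `f` and `g` over cylinders.
    refine Integrable.ae_eq_of_forall_setIntegral_eq _ _ hf'.integral_prod_left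
      hg'.integral_prod_left fun B hB _ => ?_
    rw [hset f B hf hB, hset g B hg hB]
    refine h _ ⟨(fun (x : (Sᶜ : Finset (Fin N × Bool)) → ℝ) (i : {i // i ∉ S}) =>
      x ⟨i, by simpa using i.2⟩) ⁻¹' B, ?_, rfl⟩
    exact (measurable_pi_lambda _ fun i => measurable_pi_apply _) hB
  filter_upwards [ae_splitEquiv_fst key] with z hz
  simp only [Function.comp_apply, splitEquiv_symm_apply] at hz
  exact hz

end PartialIntegrals

/-! ### Conditional expectations given a set of variables, and their products. -/

noncomputable section ConditionalExpectation

open Function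

variable {N : ℕ} {ν : Fin N × Bool → Measure ℝ} {ρ : Phase N → ℝ}

theorem ae_weighted_iff (hρ : Measurable ρ) (hρ₀ : ∀ z, 0 ≤ ρ z) {p : Phase N → Prop} :
    (∀ᵐ z ∂weighted ν ρ, p z) ↔ ∀ᵐ z ∂Measure.pi ν, ρ z ≠ 0 → p z := by
  rw [weighted, ae_withDensity_iff hρ.ennreal_ofReal]
  simp only [ne_eq, ENNReal.ofReal_eq_zero, not_le]
  refine Filter.eventually_congr (.of_forall fun z => ?_)
  rw [(hρ₀ z).lt_iff_ne']

theorem integrable_weighted_iff (hρ : Measurable ρ) (hρ₀ : ∀ z, 0 ≤ ρ z) {g : Phase N → ℝ} :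
    Integrable g (weighted ν ρ) ↔ Integrable (fun z => ρ z * g z) (Measure.pi ν) := by
  rw [weighted, integrable_withDensity_iff hρ.ennreal_ofReal (by simp)]
  simp only [ENNReal.toReal_ofReal (hρ₀ _), mul_comm]

theorem setIntegral_weighted (hρ : Measurable ρ) (hρ₀ : ∀ z, 0 ≤ ρ z) (g : Phase N → ℝ)
    {A : Set (Phase N)} (hA : MeasurableSet A) :
    ∫ z in A, g z ∂weighted ν ρ = ∫ z in A, ρ z * g z ∂Measure.pi ν := by
  have := setIntegral_withDensity_eq_setIntegral_toReal_smul (μ := Measure.pi ν)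
    (f := fun z => ENNReal.ofReal (ρ z)) hρ.ennreal_ofReal (s := A) (by simp) g hA
  simp only [ENNReal.toReal_ofReal (hρ₀ _), smul_eq_mul] at this
  exact this

theorem integral_weighted (hρ : Measurable ρ) (hρ₀ : ∀ z, 0 ≤ ρ z) (g : Phase N → ℝ) :
    ∫ z, g z ∂weighted ν ρ = ∫ z, ρ z * g z ∂Measure.pi ν := by
  simpa using setIntegral_weighted hρ hρ₀ g MeasurableSet.univ

/-- The σ-algebra generated by the variables in `S`. -/
abbrev coordinateAlgebra (S : Finset (Fin N × Bool)) : MeasurableSpace (Phase N) :=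
  Filtration.piFinset (X := fun _ => ℝ) S

theorem coordinateAlgebra_le (S : Finset (Fin N × Bool)) :
    coordinateAlgebra S ≤ MeasurableSpace.pi := (Filtration.piFinset (X := fun _ => ℝ)).le S

theorem coordinateAlgebra_mono {S T : Finset (Fin N × Bool)} (h : S ⊆ T) :
    coordinateAlgebra S ≤ coordinateAlgebra T := (Filtration.piFinset (X := fun _ => ℝ)).mono h

theorem measurable_coordinateAlgebra {f : Phase N → ℝ} (hf : Measurable f)
    {S : Finset (Fin N × Bool)} (hS : DependsOn f (S : Set (Fin N × Bool))) :
    Measurable[coordinateAlgebra S] f := by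
  -- The variables outside `S` are irrelevant to `f` and are frozen at 0.
  have : f = (fun y : S → ℝ => f (updateFinset 0 S y)) ∘ S.restrict := by
    ext z
    exact hS fun i hi => by
      rw [Finset.mem_coe] at hi
      simp [updateFinset, hi]
  rw [this]
  exact (hf.comp measurable_updateFinset).comp (comap_measurable _)

variable [∀ i, SigmaFinite (ν i)]

/-- The defining property of a conditional expectation in terms of densities. -/
theorem mul_condExp_ae_eq_integrate (hρ : Measurable ρ) (hρ₀ : ∀ z, 0 ≤ ρ z)
    [IsFiniteMeasure (weighted ν ρ)] {S : Finset (Fin N × Bool)} {r g e : Phase N → ℝ}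
    (hr : integrate ν Sᶜ ρ =ᵐ[Measure.pi ν] r) (hg : Integrable g (weighted ν ρ))
    (heS : DependsOn e (S : Set (Fin N × Bool)))
    (he : e =ᵐ[weighted ν ρ] (weighted ν ρ)[g | coordinateAlgebra S]) :
    (fun z => r z * e z) =ᵐ[Measure.pi ν] integrate ν Sᶜ (fun z => ρ z * g z) := by
  have hei : Integrable e (weighted ν ρ) := integrable_condExp.congr he.symm
  have key := integrate_ae_eq_of_setIntegral_eq (ν := ν) (S := Sᶜ)
    ((integrable_weighted_iff hρ hρ₀).1 hei) ((integrable_weighted_iff hρ hρ₀).1 hg) (by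
      intro A hA
      rw [compl_compl] at hA
      have hA' := coordinateAlgebra_le S _ hA
      rw [← setIntegral_weighted hρ hρ₀ e hA', ← setIntegral_weighted hρ hρ₀ g hA',
        ← setIntegral_condExp (coordinateAlgebra_le S) hg hA]
      exact setIntegral_congr_ae hA' (he.mono fun z hz _ => hz))
  refine Filter.EventuallyEq.trans ?_ key
  filter_upwards [hr] with z hz
  have := integrate_mul_left (ν := ν) (f := ρ) heS (disjoint_compl_right (a := S)) z
  rw [← hz, mul_comm, ← this]
  simp only [mul_comm]

/-- The representative of a conditional expectation which depends on the variables in `S` only. -/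
theorem exists_condExp_representative (μ : Measure (Phase N)) [IsFiniteMeasure μ]
    (S : Finset (Fin N × Bool)) (g : Phase N → ℝ) :
    Measurable μ[g | coordinateAlgebra S] ∧
      DependsOn μ[g | coordinateAlgebra S] (S : Set (Fin N × Bool)) :=
  ⟨(stronglyMeasurable_condExp.mono (coordinateAlgebra_le S)).measurable,
    stronglyMeasurable_condExp.dependsOn_of_piFinset⟩

/-- The formula for the conditional expectation in terms of the marginal density `r`. -/
theorem condExp_ae_eq_of_marginal (hρ : Measurable ρ) (hρ₀ : ∀ z, 0 ≤ ρ z)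
    [IsFiniteMeasure (weighted ν ρ)] {S : Finset (Fin N × Bool)} {r g : Phase N → ℝ}
    (hr : integrate ν Sᶜ ρ =ᵐ[Measure.pi ν] r) (hr₀ : ∀ᵐ z ∂weighted ν ρ, r z ≠ 0)
    (hg : Integrable g (weighted ν ρ)) :
    ∀ᵐ z ∂weighted ν ρ, (weighted ν ρ)[g | coordinateAlgebra S] z =
      1 / r z * integrate ν Sᶜ (fun w => ρ w * g w) z := by
  have h := mul_condExp_ae_eq_integrate hρ hρ₀ hr hg (exists_condExp_representative _ S g).2
    (Filter.EventuallyEq.refl _ _)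
  filter_upwards [hr₀, (ae_weighted_iff hρ hρ₀).2 (h.mono fun z hz _ => hz)] with z hz₀ hz
  rw [← hz]
  field_simp

/-- The conditional expectation as an operator on `L¹`. -/
def condExpOp (μ : Measure (Phase N)) [IsFiniteMeasure μ] (S : Finset (Fin N × Bool)) :
    Lp ℝ 1 μ →L[ℝ] Lp ℝ 1 μ :=
  condExpL1CLM ℝ (coordinateAlgebra_le S) μ

theorem condExpOp_ae_eq (μ : Measure (Phase N)) [IsFiniteMeasure μ] (S : Finset (Fin N × Bool))
    (f : Lp ℝ 1 μ) : condExpOp μ S f =ᵐ[μ] μ[f | coordinateAlgebra S] := by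
  have := condExp_ae_eq_condExpL1CLM (coordinateAlgebra_le S) (L1.integrable_coeFn f)
  rw [Integrable.toL1_coeFn] at this
  exact this.symm

theorem condExpOp_mul_ae_eq (μ : Measure (Phase N)) [IsFiniteMeasure μ]
    (S T : Finset (Fin N × Bool)) (f : Lp ℝ 1 μ) :
    (condExpOp μ S * condExpOp μ T) f =ᵐ[μ]
      μ[μ[f | coordinateAlgebra T] | coordinateAlgebra S] :=
  (condExpOp_ae_eq μ S _).trans (condExp_congr_ae (condExpOp_ae_eq μ T f))

theorem condExpOp_mul_of_subset (μ : Measure (Phase N)) [IsFiniteMeasure μ]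
    {S T : Finset (Fin N × Bool)} (h : S ⊆ T) :
    condExpOp μ S * condExpOp μ T = condExpOp μ S := by
  ext1 f
  refine Lp.ext ((condExpOp_mul_ae_eq μ S T f).trans (Filter.EventuallyEq.trans ?_
    (condExpOp_ae_eq μ S f).symm))
  exact condExp_condExp_of_le (coordinateAlgebra_mono h) (coordinateAlgebra_le T)

theorem condExpOp_mul_of_superset (μ : Measure (Phase N)) [IsFiniteMeasure μ]
    {S T : Finset (Fin N × Bool)} (h : S ⊆ T) :
    condExpOp μ T * condExpOp μ S = condExpOp μ S := by
  ext1 f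
  refine Lp.ext ((condExpOp_mul_ae_eq μ T S f).trans (Filter.EventuallyEq.trans ?_
    (condExpOp_ae_eq μ S f).symm))
  rw [condExp_of_stronglyMeasurable (coordinateAlgebra_le T)
    (stronglyMeasurable_condExp.mono (coordinateAlgebra_mono h)) integrable_condExp]

/-- If, for functions of the variables in `B`, the conditional expectation with respect to the
variables in `U` is a function of the variables in `X ⊆ U ∩ B`, then it is the conditional
expectation with respect to the latter. -/
theorem condExpOp_mul_eq_of_exists (μ : Measure (Phase N)) [IsFiniteMeasure μ]
    {U B X : Finset (Fin N × Bool)} (hXU : X ⊆ U) (hXB : X ⊆ B)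
    (h : ∀ g : Phase N → ℝ, Measurable g → DependsOn g (B : Set (Fin N × Bool)) →
      Integrable g μ → ∃ k : Phase N → ℝ, Measurable k ∧ DependsOn k (X : Set (Fin N × Bool)) ∧
        μ[g | coordinateAlgebra U] =ᵐ[μ] k) :
    condExpOp μ U * condExpOp μ B = condExpOp μ X := by
  ext1 f
  refine Lp.ext ((condExpOp_mul_ae_eq μ U B f).trans (Filter.EventuallyEq.trans ?_
    (condExpOp_ae_eq μ X f).symm))
  obtain ⟨hgm, hgB⟩ := exists_condExp_representative μ B f
  obtain ⟨k, hk, hkX, hUk⟩ := h _ hgm hgB integrable_condExp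
  have hki : Integrable k μ := integrable_condExp.congr hUk
  have h1 := condExp_of_stronglyMeasurable (μ := μ) (coordinateAlgebra_le X)
    (measurable_coordinateAlgebra hk hkX).stronglyMeasurable hki
  have h2 : μ[μ[μ[f | coordinateAlgebra B] | coordinateAlgebra U] | coordinateAlgebra X] =ᵐ[μ]
      μ[k | coordinateAlgebra X] := condExp_congr_ae hUk
  rw [h1] at h2
  refine hUk.trans (h2.symm.trans ?_)
  exact (condExp_condExp_of_le (coordinateAlgebra_mono hXU) (coordinateAlgebra_le U)).trans
    (condExp_condExp_of_le (coordinateAlgebra_mono hXB) (coordinateAlgebra_le B))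

end ConditionalExpectation

/-! ### Marginals and Markov property of a product of vertex functions and propagators along a
junction tree. -/

noncomputable section TreeDensity

open Function

variable {N : ℕ} {ν : Fin N × Bool → Measure ℝ} {V W : Finset (Vertex N)}
  {M : Finset (Vertex N × Vertex N)} {σ : Vertex N → Phase N → ℝ}

theorem mem_args {a : Vertex N} {i : Fin N × Bool} : i ∈ args a ↔ i.2 = a i.1 := by
  simp [args]

/-- The variables on which the vertex functions of `W` depend. -/
def allArgs (W : Finset (Vertex N)) : Finset (Fin N × Bool) := W.biUnion args

theorem args_subset_allArgs {a : Vertex N} (ha : a ∈ W) : args a ⊆ allArgs W :=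
  subset_biUnion_of_mem args ha

theorem compl_allArgs (W : Finset (Vertex N)) : (allArgs W)ᶜ = passiveConj W := by
  ext i
  simp [allArgs, passiveConj]

/-- Vertex functions times propagators. -/
def treeDensity (ν : Fin N × Bool → Measure ℝ) (W : Finset (Vertex N))
    (M : Finset (Vertex N × Vertex N)) (σ : Vertex N → Phase N → ℝ) (z : Phase N) : ℝ :=
  (∏ a ∈ W, σ a z) * ∏ l ∈ M, propagator ν σ l z

theorem inter_eq_of_link {b c : Vertex N} {l : Vertex N × Vertex N}
    (hl : l = (b, c) ∨ l = (c, b)) : args l.1 ∩ args l.2 = args b ∩ args c := by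
  rcases hl with rfl | rfl
  · rfl
  · exact inter_comm _ _

theorem treeDensity_insert {b : Vertex N} {l : Vertex N × Vertex N} (hb : b ∉ W) (hl : l ∉ M)
    (z : Phase N) : treeDensity ν (insert b W) (insert l M) σ z =
      treeDensity ν W M σ z * (propagator ν σ l z * σ b z) := by
  rw [treeDensity, treeDensity, prod_insert hb, prod_insert hl]
  ring

theorem _root_.DependsOn.prod {ι κ : Type*} {f : κ → (ι → ℝ) → ℝ} {s : Set ι} {K : Finset κ}
    (hf : ∀ k ∈ K, DependsOn (f k) s) : DependsOn (fun z => ∏ k ∈ K, f k z) s :=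
  fun _ _ h => prod_congr rfl fun k hk => hf k hk h

theorem propagator_eq_zero_iff {l : Vertex N × Vertex N} {z : Phase N} :
    propagator ν σ l z = 0 ↔ linkMarginal ν σ l z = 0 := by
  unfold propagator
  split_ifs with h <;> simp [h]

namespace IsChain

theorem linkMarginal_nonneg (hσ : IsChain ν V σ) {l : Vertex N × Vertex N} (hl : l.1 ∈ V)
    (z : Phase N) : 0 ≤ linkMarginal ν σ l z :=
  integral_nonneg fun _ => hσ.nonneg _ hl _

theorem propagator_nonneg (hσ : IsChain ν V σ) {l : Vertex N × Vertex N} (hl : l.1 ∈ V)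
    (z : Phase N) : 0 ≤ propagator ν σ l z := by
  unfold propagator
  split_ifs
  · exact le_rfl
  · exact one_div_nonneg.2 (hσ.linkMarginal_nonneg hl z)

theorem dependsOn_linkMarginal (hσ : IsChain ν V σ) {l : Vertex N × Vertex N} (hl : l.1 ∈ V) :
    DependsOn (linkMarginal ν σ l) ((args l.1 ∩ args l.2 : Finset _) : Set (Fin N × Bool)) := by
  rw [show args l.1 ∩ args l.2 = args l.1 \ (args l.1 \ args l.2) from
    sdiff_sdiff_right_self.symm]
  exact dependsOn_integrate (hσ.dependsOn _ hl) _

theorem dependsOn_propagator (hσ : IsChain ν V σ) {l : Vertex N × Vertex N} (hl : l.1 ∈ V) :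
    DependsOn (propagator ν σ l) ((args l.1 ∩ args l.2 : Finset _) : Set (Fin N × Bool)) :=
  (hσ.dependsOn_linkMarginal hl).comp_left fun t : ℝ => if t = 0 then 0 else 1 / t

theorem dependsOn_treeDensity (hσ : IsChain ν V σ) (hW : W ⊆ V)
    (hM : ∀ l ∈ M, l.1 ∈ W ∧ l.2 ∈ W) :
    DependsOn (treeDensity ν W M σ) (allArgs W : Set (Fin N × Bool)) := by
  refine DependsOn.mul (DependsOn.prod fun a ha => (hσ.dependsOn a (hW ha)).mono ?_)
    (DependsOn.prod fun l hl => (hσ.dependsOn_propagator (hW (hM l hl).1)).mono ?_)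
  · exact mod_cast args_subset_allArgs ha
  · exact mod_cast inter_subset_left.trans (args_subset_allArgs (hM l hl).1)

theorem treeDensity_nonneg (hσ : IsChain ν V σ) (hW : W ⊆ V)
    (hM : ∀ l ∈ M, l.1 ∈ W ∧ l.2 ∈ W) (z : Phase N) : 0 ≤ treeDensity ν W M σ z :=
  mul_nonneg (prod_nonneg fun a ha => hσ.nonneg a (hW ha) z)
    (prod_nonneg fun l hl => hσ.propagator_nonneg (hW (hM l hl).1) z)

theorem lmarginal_args (hσ : IsChain ν V σ) {a : Vertex N} (ha : a ∈ V) (z : Phase N) :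
    lmarginal ν (args a) (fun w => ENNReal.ofReal (σ a w)) z = 1 := by
  have := hσ.normalized a ha z
  rw [integrate_eq_toReal_lmarginal (hσ.measurable a ha) (hσ.nonneg a ha)] at this
  exact (ENNReal.toReal_eq_one_iff _).1 this

/-- The integrated distribution of a link can be computed from either end point. -/
theorem linkMarginal_ae_eq (hσ : IsChain ν V σ) {b c : Vertex N} (hb : b ∈ V) (hc : c ∈ V)
    {l : Vertex N × Vertex N} (hl : l = (b, c) ∨ l = (c, b)) :
    linkMarginal ν σ l =ᵐ[Measure.pi ν] integrate ν (args b \ args c) (σ b) := by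
  rcases hl with rfl | rfl
  · exact .rfl
  · exact hσ.compatible c hc b hb

variable [∀ i, SigmaFinite (ν i)]

theorem measurable_linkMarginal (hσ : IsChain ν V σ) {l : Vertex N × Vertex N} (hl : l.1 ∈ V) :
    Measurable (linkMarginal ν σ l) :=
  measurable_integrate (hσ.measurable _ hl) _

theorem measurable_propagator (hσ : IsChain ν V σ) {l : Vertex N × Vertex N} (hl : l.1 ∈ V) :
    Measurable (propagator ν σ l) := by
  have h := hσ.measurable_linkMarginal hl
  exact Measurable.ite (h (measurableSet_singleton 0)) measurable_const (h.const_div 1)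

theorem measurable_treeDensity (hσ : IsChain ν V σ) (hW : W ⊆ V)
    (hM : ∀ l ∈ M, l.1 ∈ W ∧ l.2 ∈ W) : Measurable (treeDensity ν W M σ) :=
  (Finset.measurable_prod _ fun a ha => hσ.measurable a (hW ha)).mul
    (Finset.measurable_prod _ fun l hl => hσ.measurable_propagator (hW (hM l hl).1))

/-- Integrating the left side over the remaining variables of `a` gives 1, so it is finite a.e.; the
default value of the real integral thus matters only on a null set. -/
theorem lmarginal_ae_eq (hσ : IsChain ν V σ) {a : Vertex N} (ha : a ∈ V)
    {S : Finset (Fin N × Bool)} (hS : S ⊆ args a) :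
    lmarginal ν S (fun w => ENNReal.ofReal (σ a w)) =ᵐ[Measure.pi ν]
      fun z => ENNReal.ofReal (integrate ν S (σ a) z) := by
  have hm := (hσ.measurable a ha).ennreal_ofReal
  have : ∀ᵐ z ∂Measure.pi ν, lmarginal ν S (fun w => ENNReal.ofReal (σ a w)) z < ⊤ := by
    refine ae_lt_top_of_lmarginal_lt_top (S := args a \ S) (hm.lmarginal ν) fun z => ?_
    rw [← lmarginal_union ν _ hm sdiff_disjoint, sdiff_union_of_subset hS, hσ.lmarginal_args ha]
    exact ENNReal.one_lt_top
  filter_upwards [this] with z hz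
  exact lmarginal_eq_ofReal_integrate (hσ.measurable a ha) (hσ.nonneg a ha) hz.ne

theorem lmarginal_ae_eq_linkMarginal (hσ : IsChain ν V σ) {b c : Vertex N} (hb : b ∈ V)
    (hc : c ∈ V) {l : Vertex N × Vertex N} (hl : l = (b, c) ∨ l = (c, b)) :
    lmarginal ν (args b \ args c) (fun w => ENNReal.ofReal (σ b w)) =ᵐ[Measure.pi ν]
      fun z => ENNReal.ofReal (linkMarginal ν σ l z) := by
  filter_upwards [hσ.lmarginal_ae_eq hb sdiff_subset, hσ.linkMarginal_ae_eq hb hc hl] with z h1 h2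
  rw [h1, h2]

theorem mul_lmarginal_ae_eq (hσ : IsChain ν V σ) {b c : Vertex N} (hb : b ∈ V) (hc : c ∈ V)
    {l : Vertex N × Vertex N} (hl : l = (b, c) ∨ l = (c, b)) :
    ∀ᵐ z ∂Measure.pi ν, ENNReal.ofReal (propagator ν σ l z) *
      lmarginal ν (args b \ args c) (fun w => ENNReal.ofReal (σ b w)) z =
        if propagator ν σ l z = 0 then 0 else 1 := by
  have hl1 : l.1 ∈ V := by rcases hl with rfl | rfl <;> assumption
  filter_upwards [hσ.lmarginal_ae_eq_linkMarginal hb hc hl] with z hz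
  rw [hz, ← ENNReal.ofReal_mul (hσ.propagator_nonneg hl1 z)]
  simp only [propagator_eq_zero_iff]
  unfold propagator
  split_ifs with h
  · simp
  · simp [h]

/-- The propagator is 0 exactly where the link marginal is, and there the nonnegative `σ b` has
integral 0 over the variables not common to both ends. By compatibility this applies to either end
of the link. -/
theorem eq_zero_of_propagator_eq_zero (hσ : IsChain ν V σ) {b c : Vertex N} (hb : b ∈ V)
    (hc : c ∈ V) {l : Vertex N × Vertex N} (hl : l = (b, c) ∨ l = (c, b)) :
    ∀ᵐ z ∂Measure.pi ν, propagator ν σ l z = 0 → σ b z = 0 := by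
  have hl1 : l.1 ∈ V := by rcases hl with rfl | rfl <;> assumption
  have hB : MeasurableSet {z | propagator ν σ l z = 0} :=
    hσ.measurable_propagator hl1 (measurableSet_singleton 0)
  have hind : DependsOn ({z | propagator ν σ l z = 0}.indicator fun _ => (1 : ENNReal))
      ((args b ∩ args c : Finset _) : Set (Fin N × Bool)) := by
    rw [← inter_eq_of_link hl]
    exact (hσ.dependsOn_propagator hl1).comp_left fun t : ℝ => if t = 0 then (1 : ENNReal) else 0
  have hm := (hσ.measurable b hb).ennreal_ofReal
  have key : lmarginal ν (args b \ args c) (fun z =>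
      ({z | propagator ν σ l z = 0}.indicator fun _ => (1 : ENNReal)) z *
        ENNReal.ofReal (σ b z)) =ᵐ[Measure.pi ν] 0 := by
    filter_upwards [hσ.lmarginal_ae_eq_linkMarginal hb hc hl] with z hz
    rw [lmarginal_mul_left hind (disjoint_sdiff.mono_left inter_subset_right) hm, hz]
    by_cases h : propagator ν σ l z = 0
    · simp [propagator_eq_zero_iff.1 h]
    · simp [h]
  filter_upwards [ae_eq_zero_of_lmarginal_ae_eq_zero ((measurable_const.indicator hB).mul hm) key]
    with z hz h
  refine le_antisymm ?_ (hσ.nonneg b hb z)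
  simpa [h] using hz

end IsChain

/-- A variable of `b` met earlier belongs to `c`, so the variables of `b` outside `c` are new. -/
theorem disjoint_allArgs {b c : Vertex N}
    (hsep : ∀ d ∈ W, ∀ j, d j = b j → c j = b j) :
    Disjoint (allArgs W) (args b \ args c) := by
  rw [Finset.disjoint_left]
  intro i hi hbc
  simp only [allArgs, mem_biUnion, mem_sdiff, mem_args] at hi hbc
  obtain ⟨d, hd, hid⟩ := hi
  exact hbc.2 (hbc.1.trans (hsep d hd i.1 (hid.symm.trans hbc.1)).symm)

theorem allArgs_insert {b c : Vertex N} (hc : c ∈ W) :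
    allArgs (insert b W) = (args b \ args c) ∪ allArgs W := by
  ext i
  simp only [allArgs, biUnion_insert, mem_union, mem_sdiff]
  constructor
  · rintro (h | h)
    · by_cases hi : i ∈ args c
      · exact Or.inr (mem_biUnion.2 ⟨c, hc, hi⟩)
      · exact Or.inl ⟨h, hi⟩
    · exact Or.inr h
  · rintro (h | h)
    · exact Or.inl h.1
    · exact Or.inr h

theorem compl_allArgs_eq {b c : Vertex N} (hc : c ∈ W)
    (hsep : ∀ d ∈ W, ∀ j, d j = b j → c j = b j) :
    (allArgs W)ᶜ = (args b \ args c) ∪ (allArgs (insert b W))ᶜ := by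
  have hd := disjoint_allArgs hsep
  rw [allArgs_insert hc, compl_union]
  ext i
  have : i ∈ allArgs W → i ∉ args b \ args c := fun h => Finset.disjoint_left.1 hd h
  rw [mem_union, mem_inter, mem_compl, mem_compl]
  tauto

theorem disjoint_compl_allArgs_insert {b c : Vertex N} (hc : c ∈ W) :
    Disjoint (args b \ args c) (allArgs (insert b W))ᶜ := by
  rw [allArgs_insert hc]
  exact disjoint_compl_right.mono_left subset_union_left

variable {ρ : Phase N → ℝ}

theorem integrate_ae_eq_of_lmarginal (hρ : Measurable ρ) (hρ₀ : ∀ z, 0 ≤ ρ z)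
    {S : Finset (Fin N × Bool)} {r : Phase N → ℝ} (hr : ∀ z, 0 ≤ r z)
    (h : lmarginal ν S (fun z => ENNReal.ofReal (ρ z)) =ᵐ[Measure.pi ν]
      fun z => ENNReal.ofReal (r z)) : integrate ν S ρ =ᵐ[Measure.pi ν] r := by
  filter_upwards [h] with z hz
  rw [integrate_eq_toReal_lmarginal hρ hρ₀, hz, ENNReal.toReal_ofReal (hr z)]

variable [∀ i, SigmaFinite (ν i)]

/-- Integrating out the variables of a leaf of a tree. -/
theorem IsChain.lmarginal_leaf (hσ : IsChain ν V σ) {b c : Vertex N} {l : Vertex N × Vertex N}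
    (hbW : insert b W ⊆ V) (hM : ∀ l ∈ M, l.1 ∈ W ∧ l.2 ∈ W) (hc : c ∈ W) (hb : b ∉ W)
    (hl : l = (b, c) ∨ l = (c, b)) (hlM : l ∉ M)
    (hsep : ∀ d ∈ W, ∀ j, d j = b j → c j = b j) (hρ : Measurable ρ)
    (h : lmarginal ν (allArgs (insert b W))ᶜ (fun z => ENNReal.ofReal (ρ z)) =ᵐ[Measure.pi ν]
      fun z => ENNReal.ofReal (treeDensity ν (insert b W) (insert l M) σ z)) :
    lmarginal ν (allArgs W)ᶜ (fun z => ENNReal.ofReal (ρ z)) =ᵐ[Measure.pi ν]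
      fun z => ENNReal.ofReal (treeDensity ν W M σ z) := by
  have hW : W ⊆ V := (subset_insert b W).trans hbW
  have hbV : b ∈ V := hbW (mem_insert_self b W)
  have hl1 : l.1 ∈ V := by
    rcases hl with rfl | rfl
    exacts [hbV, hW hc]
  rw [compl_allArgs_eq hc hsep, lmarginal_union ν _ hρ.ennreal_ofReal
    (disjoint_compl_allArgs_insert hc)]
  refine (lmarginal_congr_ae h _).trans ?_
  have hF : DependsOn (fun z => ENNReal.ofReal (treeDensity ν W M σ z))
      (allArgs W : Set (Fin N × Bool)) :=
    (hσ.dependsOn_treeDensity hW hM).comp_left ENNReal.ofReal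
  have hP : DependsOn (fun z => ENNReal.ofReal (propagator ν σ l z))
      ((args b ∩ args c : Finset _) : Set (Fin N × Bool)) := by
    rw [← inter_eq_of_link hl]
    exact (hσ.dependsOn_propagator hl1).comp_left ENNReal.ofReal
  have hs := (hσ.measurable b hbV).ennreal_ofReal
  have heq : (fun z => ENNReal.ofReal (treeDensity ν (insert b W) (insert l M) σ z)) =
      fun z => ENNReal.ofReal (treeDensity ν W M σ z) *
        (ENNReal.ofReal (propagator ν σ l z) * ENNReal.ofReal (σ b z)) := by
    ext z
    rw [treeDensity_insert hb hlM, ENNReal.ofReal_mul (hσ.treeDensity_nonneg hW hM z),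
      ENNReal.ofReal_mul (hσ.propagator_nonneg hl1 z)]
  rw [heq]
  filter_upwards [hσ.mul_lmarginal_ae_eq hbV (hW hc) hl,
    hσ.eq_zero_of_propagator_eq_zero (hW hc) hbV hl.symm] with z h1 h2
  rw [lmarginal_mul_left hF (disjoint_allArgs hsep)
      (f := fun z => ENNReal.ofReal (propagator ν σ l z) * ENNReal.ofReal (σ b z))
      ((hσ.measurable_propagator hl1).ennreal_ofReal.mul hs),
    lmarginal_mul_left hP (disjoint_sdiff.mono_left inter_subset_right) hs, h1]
  split_ifs with h0
  -- Where the propagator has its default value 0, the factor `σ c` of the tree density vanishes, so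
  -- nothing is lost.
  · have : treeDensity ν W M σ z = 0 := by
      rw [treeDensity, prod_eq_zero hc (h2 h0), zero_mul]
    simp [this]
  · rw [mul_one]

/-- The marginal of the root of a tree. -/
theorem JunctionTree.lmarginal_root {a : Vertex N} (hJ : JunctionTree a W M)
    (hσ : IsChain ν V σ) (hW : W ⊆ V) (hρ : Measurable ρ)
    (h : lmarginal ν (allArgs W)ᶜ (fun z => ENNReal.ofReal (ρ z)) =ᵐ[Measure.pi ν]
      fun z => ENNReal.ofReal (treeDensity ν W M σ z)) :
    lmarginal ν (args a)ᶜ (fun z => ENNReal.ofReal (ρ z)) =ᵐ[Measure.pi ν]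
      fun z => ENNReal.ofReal (σ a z) := by
  induction hJ with
  | root => simpa [allArgs, treeDensity] using h
  | step hJ hc hb hl hlM hsep ih =>
    exact ih ((subset_insert _ _).trans hW)
      (hσ.lmarginal_leaf hW hJ.mem_of_mem hc hb hl hlM hsep hρ h)

/-- The Markov property of a leaf of a tree. -/
theorem IsChain.condExpOp_leaf (hσ : IsChain ν V σ) {b c : Vertex N} {l : Vertex N × Vertex N}
    (hbW : insert b W ⊆ V) (hM : ∀ l ∈ M, l.1 ∈ W ∧ l.2 ∈ W) (hc : c ∈ W) (hb : b ∉ W)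
    (hl : l = (b, c) ∨ l = (c, b)) (hlM : l ∉ M)
    (hsep : ∀ d ∈ W, ∀ j, d j = b j → c j = b j) (hρ : Measurable ρ) (hρ₀ : ∀ z, 0 ≤ ρ z)
    [IsFiniteMeasure (weighted ν ρ)]
    (h : lmarginal ν (allArgs (insert b W))ᶜ (fun z => ENNReal.ofReal (ρ z)) =ᵐ[Measure.pi ν]
      fun z => ENNReal.ofReal (treeDensity ν (insert b W) (insert l M) σ z)) :
    condExpOp (weighted ν ρ) (allArgs W) * condExpOp (weighted ν ρ) (args b) =
      condExpOp (weighted ν ρ) (args l.1 ∩ args l.2) := by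
  have hW : W ⊆ V := (subset_insert b W).trans hbW
  have hbV : b ∈ V := hbW (mem_insert_self b W)
  have hl1 : l.1 ∈ V := by
    rcases hl with rfl | rfl
    exacts [hbV, hW hc]
  have hM' : ∀ l' ∈ insert l M, l'.1 ∈ insert b W ∧ l'.2 ∈ insert b W := by
    intro l' hl'
    rcases mem_insert.1 hl' with rfl | hl'
    · rcases hl with rfl | rfl <;> simp [hc]
    · exact ⟨mem_insert_of_mem (hM l' hl').1, mem_insert_of_mem (hM l' hl').2⟩
  have hrW := integrate_ae_eq_of_lmarginal hρ hρ₀ (hσ.treeDensity_nonneg hW hM)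
    (hσ.lmarginal_leaf hbW hM hc hb hl hlM hsep hρ h)
  have hrb := integrate_ae_eq_of_lmarginal hρ hρ₀ (hσ.treeDensity_nonneg hbW hM') h
  have hρi : Integrable ρ (Measure.pi ν) := by
    simpa using (integrable_weighted_iff hρ hρ₀).1 (integrable_const (μ := weighted ν ρ) (1 : ℝ))
  have hne : ∀ᵐ z ∂weighted ν ρ, treeDensity ν W M σ z ≠ 0 := by
    rw [ae_weighted_iff hρ hρ₀]
    have := ae_eq_zero_of_integrate_eq_zero hρi (.of_forall hρ₀) hrW
      (hσ.measurable_treeDensity hW hM)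
      (by rw [compl_compl]; exact hσ.dependsOn_treeDensity hW hM) (.of_forall fun _ => id)
    exact this.mono fun z hz h1 h2 => h1 (hz h2)
  refine condExpOp_mul_eq_of_exists _ ?_ ?_ fun g hg hgb hgi => ?_
  · rw [inter_eq_of_link hl]
    exact inter_subset_right.trans (args_subset_allArgs hc)
  · rw [inter_eq_of_link hl]
    exact inter_subset_left
  have hk₁ : DependsOn (integrate ν (args b \ args c) fun z => σ b z * g z)
      ((args b ∩ args c : Finset _) : Set (Fin N × Bool)) := by
    rw [show args b ∩ args c = args b \ (args b \ args c) from
      sdiff_sdiff_right_self.symm]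
    exact dependsOn_integrate ((hσ.dependsOn b hbV).mul hgb) _
  -- The candidate is the mean of `g` for the conditional density of `σ b` given the common
  -- variables of the link.
  refine ⟨fun z => propagator ν σ l z * integrate ν (args b \ args c) (fun z => σ b z * g z) z,
    (hσ.measurable_propagator hl1).mul (measurable_integrate ((hσ.measurable b hbV).mul hg) _),
    (hσ.dependsOn_propagator hl1).mul (by rwa [inter_eq_of_link hl]), ?_⟩
  have hmain := mul_condExp_ae_eq_integrate hρ hρ₀ hrW hgi
    (exists_condExp_representative (weighted ν ρ) (allArgs W) g).2 (Filter.EventuallyEq.refl _ _)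
  have hρg := (integrable_weighted_iff hρ hρ₀).1 hgi
  rw [compl_allArgs_eq hc hsep] at hmain
  have hin : integrate ν (allArgs (insert b W))ᶜ (fun z => ρ z * g z) =ᵐ[Measure.pi ν]
      fun z => treeDensity ν W M σ z * (propagator ν σ l z * (σ b z * g z)) := by
    filter_upwards [hrb] with z hz
    have := integrate_mul_left (ν := ν) (f := ρ) hgb
      (disjoint_compl_right.mono_left (args_subset_allArgs (mem_insert_self b W))) z
    simp only [mul_comm (ρ _)]
    rw [this, hz, treeDensity_insert hb hlM]
    ring
  have hP : DependsOn (propagator ν σ l)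
      ((args b ∩ args c : Finset _) : Set (Fin N × Bool)) := by
    rw [← inter_eq_of_link hl]
    exact hσ.dependsOn_propagator hl1
  -- The integral of `ρ g` is taken in two stages: over the variables outside all vertices, on which
  -- `g` does not depend, and then over the new variables of `b`. The tree density of `W` factors
  -- out of the second stage and is finally cancelled, being nonzero `ρ`-a.e.
  have hfin := hmain.trans ((integrate_union hρg (disjoint_compl_allArgs_insert hc)).trans
    (integrate_congr_ae hin _))
  filter_upwards [hne, (ae_weighted_iff hρ hρ₀).2 (hfin.mono fun z hz _ => hz)] with z hz₀ hz
  rw [integrate_mul_left (hσ.dependsOn_treeDensity hW hM) (disjoint_allArgs hsep),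
    integrate_mul_left hP (disjoint_sdiff.mono_left inter_subset_right)] at hz
  exact mul_left_cancel₀ hz₀ hz

/-- The algebra of the conditional expectations with respect to the vertices of a tree. -/
theorem JunctionTree.condExpOp_root {a : Vertex N} (hJ : JunctionTree a W M)
    (hσ : IsChain ν V σ) (hW : W ⊆ V) (hρ : Measurable ρ) (hρ₀ : ∀ z, 0 ≤ ρ z)
    [IsFiniteMeasure (weighted ν ρ)]
    (h : lmarginal ν (allArgs W)ᶜ (fun z => ENNReal.ofReal (ρ z)) =ᵐ[Measure.pi ν]
      fun z => ENNReal.ofReal (treeDensity ν W M σ z)) :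
    (∑ b ∈ W, condExpOp (weighted ν ρ) (args a) * condExpOp (weighted ν ρ) (args b) =
      condExpOp (weighted ν ρ) (args a) + ∑ l ∈ M,
        condExpOp (weighted ν ρ) (args a) * condExpOp (weighted ν ρ) (args l.1 ∩ args l.2)) ∧
    ∀ l ∈ M, l.1 = a → condExpOp (weighted ν ρ) (args l.1) * condExpOp (weighted ν ρ) (args l.2) =
      condExpOp (weighted ν ρ) (args l.1 ∩ args l.2) := by
  induction hJ with
  | root => simp [condExpOp_mul_of_subset _ subset_rfl]
  | @step W M b c l hJ hc hb hl hlM hsep ih =>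
    have hW' := (subset_insert _ _).trans hW
    obtain ⟨ih₁, ih₂⟩ := ih hW' (hσ.lmarginal_leaf hW hJ.mem_of_mem hc hb hl hlM hsep hρ h)
    have hleaf := hσ.condExpOp_leaf hW hJ.mem_of_mem hc hb hl hlM hsep hρ hρ₀ h
    -- As the root lies in `W`, conditioning on all of `W` may be inserted after `E_a` for free; the
    -- Markov property of the leaf then applies.
    have hab : condExpOp (weighted ν ρ) (args a) * condExpOp (weighted ν ρ) (args b) =
        condExpOp (weighted ν ρ) (args a) *
          condExpOp (weighted ν ρ) (args l.1 ∩ args l.2) := by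
      rw [← hleaf, ← mul_assoc,
        condExpOp_mul_of_subset _ (args_subset_allArgs hJ.root_mem)]
    refine ⟨?_, ?_⟩
    · rw [sum_insert hb, sum_insert hlM, ih₁, hab]
      abel
    · intro l' hl' hla
      rcases mem_insert.1 hl' with rfl | hl'
      · rcases hl with rfl | rfl
        · exact absurd hJ.root_mem (hla ▸ hb)
        · simp only at hla ⊢ hab
          subst hla
          rw [hab, condExpOp_mul_of_superset _ inter_subset_left]
      · exact ih₂ l' hl' hla

end TreeDensity

/-! ### Essential bounds and the admissible coupling constants. -/

noncomputable section Range

variable {N : ℕ} {μ : Measure (Phase N)} {h : Phase N → ℝ}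

theorem mPlus_le_iff {x : EReal} : mPlus μ h ≤ x ↔ ∀ᵐ z ∂μ, (h z : EReal) ≤ x :=
  ⟨fun hx => (ae_le_essSup (f := fun z => (h z : EReal))).mono fun _ hz => hz.trans hx,
    fun hx => essSup_le_of_ae_le x hx⟩

theorem mMinus_le_iff {x : EReal} : mMinus μ h ≤ x ↔ ∀ᵐ z ∂μ, -x ≤ (h z : EReal) := by
  rw [mMinus, EReal.neg_le]
  exact ⟨fun hx => (ae_essInf_le (f := fun z => (h z : EReal))).mono fun _ hz => hx.trans hz,
    fun hx => le_essInf_of_ae_le _ hx⟩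

/-- For `m = ⊤` both sides are false, since 1/∞ = 0 < s. -/
theorem ereal_le_inv_iff {m : EReal} (hm : 0 < m) {s : ℝ} (hs : 0 < s) :
    m ≤ ((1 / s : ℝ) : EReal) ↔ (s : EReal) ≤ 1 / m := by
  induction m with
  | bot => simp at hm
  | coe m =>
    have hm' : 0 < m := by exact_mod_cast hm
    have h1 : (1 : EReal) / (m : EReal) = ((1 / m : ℝ) : EReal) := by
      rw [EReal.coe_div]; rfl
    rw [h1, EReal.coe_le_coe_iff, EReal.coe_le_coe_iff]
    exact le_one_div hm' hs
  | top =>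
    rw [EReal.div_top]
    have h1 : ¬ (s : EReal) ≤ 0 := by
      rw [not_le]; exact_mod_cast hs
    simp [h1]

theorem one_div_ereal_nonneg {m : EReal} (hm : 0 < m) : 0 ≤ 1 / m :=
  EReal.div_nonneg zero_le_one hm.le

/-- The range of the coupling constant in which the density is not negative. -/
theorem ae_nonneg_iff_inRange (hh : ¬ h =ᵐ[μ] 0 → 0 < mPlus μ h ∧ 0 < mMinus μ h) (t : ℝ) :
    (∀ᵐ z ∂μ, 0 ≤ 1 + t * h z) ↔ InRange μ h t := by
  by_cases h0 : h =ᵐ[μ] 0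
  · refine iff_of_true ?_ (Or.inl h0)
    filter_upwards [h0] with z hz
    simp [hz]
  obtain ⟨hp, hm⟩ := hh h0
  simp only [InRange, h0, false_or]
  have hp0 := one_div_ereal_nonneg hp
  have hm0 := one_div_ereal_nonneg hm
  -- Only one bound is active for each sign of `t`: `mPlus` for negative and `mMinus` for positive
  -- `t`. The other holds because `1 / m ≥ 0`.
  rcases lt_trichotomy t 0 with ht | rfl | ht
  · have h1 : (t : EReal) ≤ 1 / mMinus μ h := le_trans (by exact_mod_cast ht.le) hm0
    rw [and_iff_left h1, EReal.neg_le, ← EReal.coe_neg,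
      ← ereal_le_inv_iff hp (neg_pos.2 ht), mPlus_le_iff]
    refine Filter.eventually_congr (.of_forall fun z => ?_)
    rw [EReal.coe_le_coe_iff, le_div_iff₀ (neg_pos.2 ht)]
    constructor <;> intro h <;> linarith
  · refine iff_of_true (by simp) ⟨?_, by simpa using hm0⟩
    rw [EReal.neg_le]
    simpa using hp0
  · have h1 : -(1 / mPlus μ h) ≤ (t : EReal) := by
      rw [EReal.neg_le]
      refine le_trans ?_ hp0
      rw [← EReal.coe_neg]
      exact_mod_cast (neg_neg_of_pos ht).le
    rw [and_iff_right h1, ← ereal_le_inv_iff hm ht, mMinus_le_iff]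
    refine Filter.eventually_congr (.of_forall fun z => ?_)
    rw [← EReal.coe_neg, EReal.coe_le_coe_iff, neg_le_iff_add_nonneg', ← mul_nonneg_iff_of_pos_left (b := 1 / t + _) ht,
      mul_add, mul_one_div_cancel ht.ne']

/-- A function of one sign with mean zero vanishes a.e. -/
theorem mPlus_pos_and_mMinus_pos (hi : Integrable h μ) (hint : ∫ z, h z ∂μ = 0)
    (h0 : ¬ h =ᵐ[μ] 0) : 0 < mPlus μ h ∧ 0 < mMinus μ h := by
  constructor
  · by_contra hcon
    rw [not_lt, mPlus_le_iff] at hcon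
    have h1 : 0 ≤ᵐ[μ] fun z => -h z := hcon.mono fun z hz => by
      have : h z ≤ 0 := by exact_mod_cast hz
      simpa using this
    have h2 := (integral_eq_zero_iff_of_nonneg_ae h1 hi.neg).1 (by rw [integral_neg, hint, neg_zero])
    exact h0 (h2.mono fun z hz => by simpa using hz)
  · by_contra hcon
    rw [not_lt, mMinus_le_iff] at hcon
    have h1 : 0 ≤ᵐ[μ] h := hcon.mono fun z hz => by
      rw [neg_zero] at hz
      exact_mod_cast hz
    exact h0 ((integral_eq_zero_iff_of_nonneg_ae h1 hi).1 hint)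

end Range

/-! ### Normalization and support of the particular solution; adding homogeneous solutions. -/

noncomputable section ParticularSolution

variable {N : ℕ} {ν : Fin N × Bool → Measure ℝ} {V : Finset (Vertex N)}
  {L : Finset (Vertex N × Vertex N)} {σ : Vertex N → Phase N → ℝ} {ζ : Phase N → ℝ}

theorem rho0_eq (z : Phase N) : rho0 ν V L σ ζ z = treeDensity ν V L σ z * ζ z := rfl

theorem IsPassiveDensity.lmarginal_eq_one (hζ : IsPassiveDensity ν V ζ) (z : Phase N) :
    lmarginal ν (passiveConj V) (fun w => ENNReal.ofReal (ζ w)) z = 1 := by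
  have := hζ.normalized z
  rw [integrate_eq_toReal_lmarginal hζ.measurable hζ.nonneg] at this
  exact (ENNReal.toReal_eq_one_iff _).1 this

theorem IsChain.rho0_nonneg (hσ : IsChain ν V σ) (hζ : IsPassiveDensity ν V ζ)
    (hL : ∀ l ∈ L, l.1 ∈ V ∧ l.2 ∈ V) (z : Phase N) : 0 ≤ rho0 ν V L σ ζ z :=
  mul_nonneg (hσ.treeDensity_nonneg subset_rfl hL z) (hζ.nonneg z)

theorem IsChain.lmarginal_rho0 (hσ : IsChain ν V σ) (hζ : IsPassiveDensity ν V ζ)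
    (hL : ∀ l ∈ L, l.1 ∈ V ∧ l.2 ∈ V) (z : Phase N) :
    lmarginal ν (allArgs V)ᶜ (fun w => ENNReal.ofReal (rho0 ν V L σ ζ w)) z =
      ENNReal.ofReal (treeDensity ν V L σ z) := by
  simp only [rho0_eq, ENNReal.ofReal_mul (hσ.treeDensity_nonneg subset_rfl hL _)]
  have hF : DependsOn (fun z => ENNReal.ofReal (treeDensity ν V L σ z))
      (allArgs V : Set (Fin N × Bool)) :=
    (hσ.dependsOn_treeDensity subset_rfl hL).comp_left ENNReal.ofReal
  rw [lmarginal_mul_left hF disjoint_compl_right hζ.measurable.ennreal_ofReal, compl_allArgs,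
    hζ.lmarginal_eq_one, mul_one]

variable [∀ i, SigmaFinite (ν i)]

theorem IsChain.measurable_rho0 (hσ : IsChain ν V σ) (hζ : IsPassiveDensity ν V ζ)
    (hL : ∀ l ∈ L, l.1 ∈ V ∧ l.2 ∈ V) : Measurable (rho0 ν V L σ ζ) :=
  (hσ.measurable_treeDensity subset_rfl hL).mul hζ.measurable

theorem measure_ne_zero_of_lmarginal_eq_one {S : Finset (Fin N × Bool)} {f : Phase N → ENNReal}
    {z : Phase N} (h : lmarginal ν S f z = 1) {i : Fin N × Bool} (hi : i ∈ S) :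
    ν i Set.univ ≠ 0 := by
  intro h0
  have : Measure.pi (fun i : S => ν i) = 0 := by
    rw [← Measure.measure_univ_eq_zero, Measure.pi_univ]
    exact prod_eq_zero (mem_univ (⟨i, hi⟩ : S)) h0
  rw [lmarginal, this, lintegral_zero_measure] at h
  exact zero_ne_one h

/-- Every variable is an argument of some `σ a` or of `ζ`, and a normalized density cannot live on a
zero measure. -/
theorem IsChain.measure_pi_ne_zero (hσ : IsChain ν V σ) (hζ : IsPassiveDensity ν V ζ) :
    Measure.pi ν ≠ 0 := by
  rw [ne_eq, ← Measure.measure_univ_eq_zero, Measure.pi_univ]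
  refine prod_ne_zero_iff.2 fun i _ => ?_
  by_cases hi : i ∈ allArgs V
  · obtain ⟨a, ha, hia⟩ := mem_biUnion.1 hi
    exact measure_ne_zero_of_lmarginal_eq_one (hσ.lmarginal_args ha 0) hia
  · refine measure_ne_zero_of_lmarginal_eq_one (hζ.lmarginal_eq_one 0) ?_
    rwa [← compl_allArgs, mem_compl]

/-- The total mass, as an iterated integral, agrees with that of `σ a` at almost every base point;
since the measure is nonzero, such a point exists. -/
theorem IsChain.lintegral_eq_one (hσ : IsChain ν V σ) (hν : Measure.pi ν ≠ 0) {ρ : Phase N → ℝ}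
    (hρ : Measurable ρ) {a : Vertex N} (ha : a ∈ V)
    (h : lmarginal ν (args a)ᶜ (fun z => ENNReal.ofReal (ρ z)) =ᵐ[Measure.pi ν]
      fun z => ENNReal.ofReal (σ a z)) :
    ∫⁻ z, ENNReal.ofReal (ρ z) ∂Measure.pi ν = 1 := by
  have : (ae (Measure.pi ν)).NeBot := ae_neBot.2 hν
  obtain ⟨z, hz⟩ := (lmarginal_congr_ae h (args a)).exists
  rw [hσ.lmarginal_args ha] at hz
  rw [← hz, lmarginal_comm _ hρ.ennreal_ofReal (args a)ᶜ z, compl_compl]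

theorem Reproduces.marginal_link {ρ : Phase N → ℝ}
    (hrep : Reproduces ν V σ ρ) (hρ : Integrable ρ (Measure.pi ν)) {l : Vertex N × Vertex N}
    (hl : l.1 ∈ V) :
    integrate ν (args l.1 ∩ args l.2)ᶜ ρ =ᵐ[Measure.pi ν] linkMarginal ν σ l := by
  have h1 : (args l.1 ∩ args l.2)ᶜ = (args l.1 \ args l.2) ∪ (args l.1)ᶜ := by
    ext i
    simp only [mem_compl, mem_inter, mem_union, mem_sdiff]
    tauto
  rw [h1]
  exact (integrate_union hρ (disjoint_compl_right.mono_left sdiff_subset)).trans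
    (integrate_congr_ae (hrep _ hl) _)

/-- A solution vanishes where a vertex function vanishes. -/
theorem IsChain.eq_zero_of_vertex_eq_zero (hσ : IsChain ν V σ) {ρ : Phase N → ℝ}
    (hρ : Integrable ρ (Measure.pi ν)) (hρ₀ : ∀ᵐ z ∂Measure.pi ν, 0 ≤ ρ z)
    (hrep : Reproduces ν V σ ρ) {a : Vertex N} (ha : a ∈ V) :
    ∀ᵐ z ∂Measure.pi ν, σ a z = 0 → ρ z = 0 :=
  ae_eq_zero_of_integrate_eq_zero hρ hρ₀ (hrep a ha) (hσ.measurable a ha)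
    (by rw [compl_compl]; exact hσ.dependsOn a ha) (.of_forall fun _ => id)

/-- A solution vanishes where the particular solution vanishes, if this holds for the density of
the passive variables. -/
theorem IsChain.eq_zero_of_rho0_eq_zero (hσ : IsChain ν V σ) {ρ : Phase N → ℝ}
    (hL : ∀ l ∈ L, l.1 ∈ V ∧ l.2 ∈ V)
    (hρ : IsDensity ν ρ) (hrep : Reproduces ν V σ ρ)
    (hζρ : ∀ᵐ z ∂Measure.pi ν, ζ z = 0 → ρ z = 0) :
    ∀ᵐ z ∂Measure.pi ν, rho0 ν V L σ ζ z = 0 → ρ z = 0 := by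
  have hv : ∀ᵐ z ∂Measure.pi ν, ∀ a ∈ V, σ a z = 0 → ρ z = 0 := by
    rw [Finset.eventually_all]
    exact fun a ha => hσ.eq_zero_of_vertex_eq_zero hρ.integrable hρ.nonneg hrep ha
  have hp : ∀ᵐ z ∂Measure.pi ν, ∀ l ∈ L, propagator ν σ l z = 0 → σ l.1 z = 0 := by
    rw [Finset.eventually_all]
    exact fun l hl => hσ.eq_zero_of_propagator_eq_zero (hL l hl).1 (hL l hl).2 (Or.inl rfl)
  filter_upwards [hv, hp, hζρ] with z h1 h2 h3 h0
  rcases mul_eq_zero.1 h0 with h | h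
  · rcases mul_eq_zero.1 h with h | h
    · obtain ⟨a, ha, h⟩ := prod_eq_zero_iff.1 h
      exact h1 a ha h
    · obtain ⟨l, hl, h⟩ := prod_eq_zero_iff.1 h
      exact h1 _ (hL l hl).1 (h2 l hl h)
  · exact h3 h

/-- Adding a solution of the homogeneous linear equations. -/
theorem reproduces_add {ρ₀ : Phase N → ℝ} (hρ : Measurable ρ₀) (hρ₀ : ∀ z, 0 ≤ ρ₀ z)
    (hi : Integrable ρ₀ (Measure.pi ν)) (hrep : Reproduces ν V σ ρ₀)
    {h : Lp ℝ 1 (weighted ν ρ₀)}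
    (h0 : ∀ a ∈ V, integrate ν (args a)ᶜ (fun z => ρ₀ z * h z) =ᵐ[Measure.pi ν] 0) (t : ℝ) :
    Integrable (fun z => ρ₀ z * (1 + t * h z)) (Measure.pi ν) ∧
      Reproduces ν V σ fun z => ρ₀ z * (1 + t * h z) := by
  have hhi := (integrable_weighted_iff hρ hρ₀).1 (L1.integrable_coeFn h)
  have heq : (fun z => ρ₀ z * (1 + t * h z)) = fun z => ρ₀ z + t * (ρ₀ z * h z) := by
    ext z; ring
  rw [heq]
  refine ⟨hi.add (hhi.const_mul t), fun a ha => ?_⟩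
  filter_upwards [hrep a ha, h0 a ha, ae_integrable_updateFinset hi (args a)ᶜ,
    ae_integrable_updateFinset hhi (args a)ᶜ] with z h1 h2 h3 h4
  unfold integrate at h1 h2 ⊢
  rw [integral_add h3 (h4.const_mul t), integral_const_mul, h1, h2]
  simp

end ParticularSolution

/-! ### Conditional expectations as the explicit vertex and link means. -/

noncomputable section Projector

variable {N : ℕ} {ν : Fin N × Bool → Measure ℝ} {V : Finset (Vertex N)}
  {L : Finset (Vertex N × Vertex N)} {σ : Vertex N → Phase N → ℝ} {ρ₀ : Phase N → ℝ}
  [∀ i, SigmaFinite (ν i)] [IsFiniteMeasure (weighted ν ρ₀)]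

/-- Translates the operator equation, which holds only `ρ₀`-a.e., into the linear equation for
densities, a.e. for the reference measure. -/
theorem condExpOp_eq_zero_iff (hσ : IsChain ν V σ) (hρ : Measurable ρ₀) (hρ₀ : ∀ z, 0 ≤ ρ₀ z)
    (hi : Integrable ρ₀ (Measure.pi ν)) (hrep : Reproduces ν V σ ρ₀) {a : Vertex N} (ha : a ∈ V)
    (h : Lp ℝ 1 (weighted ν ρ₀)) : condExpOp (weighted ν ρ₀) (args a) h = 0 ↔
      integrate ν (args a)ᶜ (fun z => ρ₀ z * h z) =ᵐ[Measure.pi ν] 0 := by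
  rw [Lp.eq_zero_iff_ae_eq_zero]
  have hop := condExpOp_ae_eq (weighted ν ρ₀) (args a) h
  constructor
  · intro h0
    have he : (fun _ => (0 : ℝ)) =ᵐ[weighted ν ρ₀] (weighted ν ρ₀)[h | coordinateAlgebra (args a)] :=
      h0.symm.trans hop
    -- The constant 0 serves as the representative depending only on the variables of `a`, which
    -- gives an identity also off the support of `ρ₀`.
    have := mul_condExp_ae_eq_integrate hρ hρ₀ (hrep a ha) (L1.integrable_coeFn h)
      ((dependsOn_const 0).mono (Set.empty_subset _)) he
    exact this.symm.trans (.of_forall fun z => by simp)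
  · intro h0
    have hne : ∀ᵐ z ∂weighted ν ρ₀, σ a z ≠ 0 := (ae_weighted_iff hρ hρ₀).2
      ((hσ.eq_zero_of_vertex_eq_zero hi (.of_forall hρ₀) hrep ha).mono fun z hz h1 h2 => h1 (hz h2))
    refine hop.trans ?_
    filter_upwards [condExp_ae_eq_of_marginal hρ hρ₀ (hrep a ha) hne (L1.integrable_coeFn h),
      (ae_weighted_iff hρ hρ₀).2 (h0.mono fun z hz _ => hz)] with z h1 h2
    rw [h1, h2]
    simp

theorem condExpOp_ae_eq_vertexMean (hσ : IsChain ν V σ) (hρ : Measurable ρ₀)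
    (hρ₀ : ∀ z, 0 ≤ ρ₀ z) (hi : Integrable ρ₀ (Measure.pi ν)) (hrep : Reproduces ν V σ ρ₀)
    {a : Vertex N} (ha : a ∈ V) (g : Lp ℝ 1 (weighted ν ρ₀)) :
    condExpOp (weighted ν ρ₀) (args a) g =ᵐ[weighted ν ρ₀] vertexMean ν σ ρ₀ a g := by
  have hne : ∀ᵐ z ∂weighted ν ρ₀, σ a z ≠ 0 := (ae_weighted_iff hρ hρ₀).2
    ((hσ.eq_zero_of_vertex_eq_zero hi (.of_forall hρ₀) hrep ha).mono fun z hz h1 h2 => h1 (hz h2))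
  refine (condExpOp_ae_eq (weighted ν ρ₀) (args a) g).trans ?_
  filter_upwards [hne, condExp_ae_eq_of_marginal hρ hρ₀ (hrep a ha) hne (L1.integrable_coeFn g)]
    with z h0 h1
  rw [h1, vertexMean, if_neg h0]

theorem condExpOp_ae_eq_linkMean (hσ : IsChain ν V σ) (hρ : Measurable ρ₀)
    (hρ₀ : ∀ z, 0 ≤ ρ₀ z) (hi : Integrable ρ₀ (Measure.pi ν)) (hrep : Reproduces ν V σ ρ₀)
    {l : Vertex N × Vertex N} (hl : l.1 ∈ V) (g : Lp ℝ 1 (weighted ν ρ₀)) :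
    condExpOp (weighted ν ρ₀) (args l.1 ∩ args l.2) g =ᵐ[weighted ν ρ₀] linkMean ν σ ρ₀ l g := by
  have hmarg := hrep.marginal_link hi hl
  have hne : ∀ᵐ z ∂weighted ν ρ₀, linkMarginal ν σ l z ≠ 0 := by
    rw [ae_weighted_iff hρ hρ₀]
    have := ae_eq_zero_of_integrate_eq_zero hi (.of_forall hρ₀) hmarg
      (hσ.measurable_linkMarginal hl)
      (by rw [compl_compl]; exact hσ.dependsOn_linkMarginal hl) (.of_forall fun _ => id)
    exact this.mono fun z hz h1 h2 => h1 (hz h2)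
  refine (condExpOp_ae_eq (weighted ν ρ₀) _ g).trans ?_
  filter_upwards [hne, condExp_ae_eq_of_marginal hρ hρ₀ hmarg hne (L1.integrable_coeFn g)]
    with z h0 h1
  rw [h1, linkMean, propagator, if_neg h0]

theorem integral_eq_zero_of_condExpOp_eq_zero (μ : Measure (Phase N)) [IsFiniteMeasure μ]
    {S : Finset (Fin N × Bool)} {h : Lp ℝ 1 μ} (h0 : condExpOp μ S h = 0) :
    ∫ z, h z ∂μ = 0 := by
  have h1 := (condExpOp_ae_eq μ S h).symm
  rw [h0] at h1
  rw [← integral_condExp (coordinateAlgebra_le S), integral_congr_ae (h1.trans (Lp.coeFn_zero _ _ _))]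
  simp

end Projector

end CCS

/-! ### Assembly of the theorem. -/

theorem mainTheorem5 {N : ℕ} (ν : Fin N × Bool → Measure ℝ) [∀ i, SigmaFinite (ν i)]
    (V Vc : Finset (CCS.Vertex N)) (hV : V ⊆ Vc)
    (hconn : (CCS.graph Vc).Connected) (hproper : CCS.IsProper Vc) (hsimple : CCS.IsSimple V Vc)
    (L : Finset (CCS.Vertex N × CCS.Vertex N)) (hL : CCS.IsLinkList V Vc L)
    (σ : CCS.Vertex N → CCS.Phase N → ℝ) (hσ : CCS.IsChain ν V σ)
    (ζ : CCS.Phase N → ℝ) (hζ : CCS.IsPassiveDensity ν V ζ)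
    (ρ₀ : CCS.Phase N → ℝ) (hρ₀ : ρ₀ = CCS.rho0 ν V L σ ζ)
    (μ₀ : Measure (CCS.Phase N)) (hμ₀ : μ₀ = CCS.weighted ν ρ₀) :
    -- `ρ₀` is a probability density which reproduces the chain
    CCS.IsDensity ν ρ₀ ∧ CCS.Reproduces ν V σ ρ₀ ∧
    -- the operators `P_a` and `Π` on `L¹(ρ₀ dq dp)`
    ∃ (P : CCS.Vertex N → (Lp ℝ 1 μ₀ →L[ℝ] Lp ℝ 1 μ₀)) (Pi : Lp ℝ 1 μ₀ →L[ℝ] Lp ℝ 1 μ₀),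
      (∀ a ∈ V, ∀ g : Lp ℝ 1 μ₀, P a g =ᵐ[μ₀] CCS.vertexMean ν σ ρ₀ a g) ∧
      (∀ a ∈ V, P a * P a = P a) ∧
      Pi = 1 - ∑ a ∈ V, P a + ∑ l ∈ L, P l.1 * P l.2 ∧
      Pi * Pi = Pi ∧
      (∀ a ∈ V, P a * Pi = 0) ∧
      -- the solutions of the linear equations are the functions `h = Π f`
      (∀ h : Lp ℝ 1 μ₀, (∀ a ∈ V, P a h = 0) ↔ ∃ f, h = Pi f) ∧
      -- the explicit form of `h = Π f`
      (∀ f : Lp ℝ 1 μ₀, ∀ᵐ z ∂μ₀, Pi f z =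
        f z - ∑ a ∈ V, CCS.vertexMean ν σ ρ₀ a f z + ∑ l ∈ L, CCS.linkMean ν σ ρ₀ l f z) ∧
      -- `ρ₀ (1 + λ h)` reproduces the chain, and is non negative iff `-1/m₊ ≤ λ ≤ 1/m₋`
      (∀ (f : Lp ℝ 1 μ₀) (t : ℝ),
        Integrable (fun z => ρ₀ z * (1 + t * Pi f z)) (Measure.pi ν) ∧
        CCS.Reproduces ν V σ (fun z => ρ₀ z * (1 + t * Pi f z)) ∧
        ((∀ᵐ z ∂Measure.pi ν, 0 ≤ ρ₀ z * (1 + t * Pi f z)) ↔ CCS.InRange μ₀ (Pi f) t)) ∧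
      (∀ f : Lp ℝ 1 μ₀, Pi f ≠ 0 → 0 < CCS.mPlus μ₀ (Pi f) ∧ 0 < CCS.mMinus μ₀ (Pi f)) ∧
      -- every solution vanishing where `ζ` vanishes (every solution, if `ζ > 0`) is of this form
      (∀ ρ : CCS.Phase N → ℝ,
        (CCS.IsDensity ν ρ ∧ CCS.Reproduces ν V σ ρ ∧
            ∀ᵐ z ∂Measure.pi ν, ζ z = 0 → ρ z = 0) ↔
          ∃ (f : Lp ℝ 1 μ₀) (t : ℝ), CCS.InRange μ₀ (Pi f) t ∧
            ρ =ᵐ[Measure.pi ν] fun z => ρ₀ z * (1 + t * Pi f z)) := by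
  open CCS in
  have hLV : ∀ l ∈ L, l.1 ∈ V ∧ l.2 ∈ V := fun l hl =>
    ⟨(hL.isLink l.1 l.2 hl).1, (hL.isLink l.1 l.2 hl).2.1⟩
  obtain ⟨a₀, ha₀⟩ := nonempty_of_isSimple hconn hproper hsimple
  have hJ : ∀ a ∈ V, JunctionTree a V L := fun a ha =>
    junctionTree_of_isLinkList hV hconn hproper hsimple hL ha
  have hm : Measurable ρ₀ := hρ₀ ▸ hσ.measurable_rho0 hζ hLV
  have hnn : ∀ z, 0 ≤ ρ₀ z := hρ₀ ▸ hσ.rho0_nonneg hζ hLV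
  have hmarg : lmarginal ν (allArgs V)ᶜ (fun z => ENNReal.ofReal (ρ₀ z)) =ᵐ[Measure.pi ν]
      fun z => ENNReal.ofReal (treeDensity ν V L σ z) :=
    .of_forall (hρ₀ ▸ hσ.lmarginal_rho0 hζ hLV)
  have hroot : ∀ a ∈ V, lmarginal ν (args a)ᶜ (fun z => ENNReal.ofReal (ρ₀ z)) =ᵐ[Measure.pi ν]
      fun z => ENNReal.ofReal (σ a z) := fun a ha => (hJ a ha).lmarginal_root hσ subset_rfl hm hmarg
  have hrep : Reproduces ν V σ ρ₀ := fun a ha =>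
    integrate_ae_eq_of_lmarginal hm hnn (hσ.nonneg a ha) (hroot a ha)
  have hone : ∫⁻ z, ENNReal.ofReal (ρ₀ z) ∂Measure.pi ν = 1 :=
    hσ.lintegral_eq_one (hσ.measure_pi_ne_zero hζ) hm ha₀ (hroot a₀ ha₀)
  have hi : Integrable ρ₀ (Measure.pi ν) :=
    ⟨hm.aestronglyMeasurable, by
      rw [hasFiniteIntegral_iff_ofReal (.of_forall hnn), hone]; exact ENNReal.one_lt_top⟩
  have hint : ∫ z, ρ₀ z ∂Measure.pi ν = 1 := by
    rw [integral_eq_lintegral_of_nonneg_ae (.of_forall hnn) hm.aestronglyMeasurable, hone,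
      ENNReal.toReal_one]
  subst hμ₀
  have hfin : IsFiniteMeasure (weighted ν ρ₀) := by
    refine ⟨?_⟩
    rw [weighted, withDensity_apply _ MeasurableSet.univ, Measure.restrict_univ, hone]
    exact ENNReal.one_lt_top
  refine ⟨⟨hi, .of_forall hnn, hint⟩, hrep, ?_⟩
  -- The root being arbitrary, it is placed at the first end of each link in turn.
  have hPP : ∀ l ∈ L, condExpOp (weighted ν ρ₀) (args l.1) * condExpOp (weighted ν ρ₀) (args l.2) =
      condExpOp (weighted ν ρ₀) (args l.1 ∩ args l.2) := fun l hl =>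
    ((hJ l.1 (hLV l hl).1).condExpOp_root hσ subset_rfl hm hnn hmarg).2 l hl rfl
  obtain ⟨P, hP⟩ : ∃ P : Vertex N → (Lp ℝ 1 (weighted ν ρ₀) →L[ℝ] Lp ℝ 1 (weighted ν ρ₀)),
    P = fun a => condExpOp (weighted ν ρ₀) (args a) := ⟨_, rfl⟩
  obtain ⟨Pi, hPi⟩ : ∃ Pi, Pi = 1 - ∑ a ∈ V, P a + ∑ l ∈ L, P l.1 * P l.2 := ⟨_, rfl⟩
  have hPl : ∀ l ∈ L, P l.1 * P l.2 = condExpOp (weighted ν ρ₀) (args l.1 ∩ args l.2) := by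
    rw [hP]; exact hPP
  have hPPi : ∀ a ∈ V, P a * Pi = 0 := by
    intro a ha
    have := ((hJ a ha).condExpOp_root hσ subset_rfl hm hnn hmarg).1
    rw [hPi, sum_congr rfl hPl, mul_add, mul_sub, mul_one, mul_sum, mul_sum]
    simp only [hP]
    rw [this]
    abel
  have hPzero : ∀ a ∈ V, ∀ f, P a (Pi f) = 0 := fun a ha f => by
    have := congrArg (fun T => T f) (hPPi a ha)
    simpa using this
  have hfix : ∀ h, (∀ a ∈ V, P a h = 0) → Pi h = h := by
    intro h hh
    have h2 : ∑ l ∈ L, (P l.1 * P l.2) h = 0 := sum_eq_zero fun l hl => by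
      rw [mul_apply_eq_comp, hh _ (hLV l hl).2, map_zero]
    rw [hPi]
    simp only [_root_.add_apply, _root_.sub_apply,
      _root_.sum_apply, one_apply_eq_self, sum_eq_zero hh, h2]
    simp
  have hzero : ∀ f, ∀ a ∈ V,
      integrate ν (args a)ᶜ (fun z => ρ₀ z * Pi f z) =ᵐ[Measure.pi ν] 0 := fun f a ha => by
    rw [← condExpOp_eq_zero_iff hσ hm hnn hi hrep ha]
    have := hPzero a ha f
    rwa [hP] at this
  have hintPi : ∀ f, ∫ z, Pi f z ∂weighted ν ρ₀ = 0 := fun f => by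
    have := hPzero a₀ ha₀ f
    rw [hP] at this
    exact integral_eq_zero_of_condExpOp_eq_zero _ this
  have hpos : ∀ f, ¬ Pi f =ᵐ[weighted ν ρ₀] 0 →
      0 < mPlus (weighted ν ρ₀) (Pi f) ∧ 0 < mMinus (weighted ν ρ₀) (Pi f) := fun f =>
    mPlus_pos_and_mMinus_pos (L1.integrable_coeFn _) (hintPi f)
  have hrange : ∀ f t, (∀ᵐ z ∂Measure.pi ν, 0 ≤ ρ₀ z * (1 + t * Pi f z)) ↔
      InRange (weighted ν ρ₀) (Pi f) t := by
    intro f t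
    rw [← ae_nonneg_iff_inRange (hpos f), ae_weighted_iff hm hnn]
    refine Filter.eventually_congr (.of_forall fun z => ?_)
    rcases (hnn z).eq_or_lt with h | h
    · simp [← h]
    · rw [mul_nonneg_iff_of_pos_left h]
      simp [h.ne']
  have hadd := fun f => reproduces_add (σ := σ) hm hnn hi hrep (hzero f)
  refine ⟨P, Pi, ?_, ?_, hPi, ?_, hPPi, ?_, ?_, fun f t => ⟨(hadd f t).1, (hadd f t).2, hrange f t⟩,
    fun f hf => hpos f fun h => hf ((Lp.eq_zero_iff_ae_eq_zero).2 h), ?_⟩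
  · intro a ha g
    rw [hP]
    exact condExpOp_ae_eq_vertexMean hσ hm hnn hi hrep ha g
  · intro a _
    rw [hP]
    exact condExpOp_mul_of_subset _ subset_rfl
  · ext1 f
    exact hfix _ fun a ha => hPzero a ha f
  · exact fun h => ⟨fun hh => ⟨h, (hfix h hh).symm⟩, fun ⟨f, hf⟩ a ha => hf ▸ hPzero a ha f⟩
  · intro f
    have h1 : ∀ᵐ z ∂weighted ν ρ₀, ∀ a ∈ V, P a f z = vertexMean ν σ ρ₀ a f z := by
      rw [Finset.eventually_all, hP]
      exact fun a ha => condExpOp_ae_eq_vertexMean hσ hm hnn hi hrep ha f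
    have h2 : ∀ᵐ z ∂weighted ν ρ₀, ∀ l ∈ L, (P l.1 * P l.2) f z = linkMean ν σ ρ₀ l f z := by
      rw [Finset.eventually_all]
      intro l hl
      rw [hPl l hl]
      exact condExpOp_ae_eq_linkMean hσ hm hnn hi hrep (hLV l hl).1 f
    have h3 : Pi f = f - ∑ a ∈ V, P a f + ∑ l ∈ L, (P l.1 * P l.2) f := by
      rw [hPi]
      simp only [_root_.add_apply, _root_.sub_apply,
        _root_.sum_apply, one_apply_eq_self]
    rw [h3]
    filter_upwards [h1, h2, Lp.coeFn_add (f - ∑ a ∈ V, P a f) (∑ l ∈ L, (P l.1 * P l.2) f),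
      Lp.coeFn_sub f (∑ a ∈ V, P a f), Lp.coeFn_finsetSum V fun a => P a f,
      Lp.coeFn_finsetSum L fun l => (P l.1 * P l.2) f] with z h1 h2 h4 h5 h6 h7
    rw [h4, _root_.Pi.add_apply, h5, _root_.Pi.sub_apply, h6, h7, Finset.sum_apply, Finset.sum_apply,
      sum_congr rfl h1, sum_congr rfl h2]
  · intro ρ
    constructor
    · rintro ⟨hρ, hρrep, hρζ⟩
      -- Absolute continuity with respect to `ρ₀`: it makes `ρ / ρ₀ - 1` a legitimate `h`, the value
      -- of the quotient at `ρ₀ = 0` being irrelevant.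
      have hvan : ∀ᵐ z ∂Measure.pi ν, ρ₀ z = 0 → ρ z = 0 := by
        rw [hρ₀]; exact hσ.eq_zero_of_rho0_eq_zero hLV hρ hρrep hρζ
      have hmul : (fun z => ρ₀ z * (ρ z / ρ₀ z - 1)) =ᵐ[Measure.pi ν] fun z => ρ z - ρ₀ z := by
        filter_upwards [hvan] with z hz
        by_cases h0 : ρ₀ z = 0
        · simp [h0, hz h0]
        · field_simp
      have hhi : Integrable (fun z => ρ z / ρ₀ z - 1) (weighted ν ρ₀) :=
        (integrable_weighted_iff hm hnn).2 ((hρ.integrable.sub hi).congr hmul.symm)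
      have hF : ∀ᵐ z ∂Measure.pi ν, ρ₀ z ≠ 0 → hhi.toL1 _ z = ρ z / ρ₀ z - 1 :=
        (ae_weighted_iff hm hnn).1 hhi.coeFn_toL1
      have hmulF : (fun z => ρ₀ z * hhi.toL1 _ z) =ᵐ[Measure.pi ν] fun z => ρ z - ρ₀ z := by
        filter_upwards [hmul, hF] with z h1 h2
        rw [← h1]
        by_cases h0 : ρ₀ z = 0
        · simp [h0]
        · rw [h2 h0]
      have hPF : Pi (hhi.toL1 _) = hhi.toL1 _ := by
        refine hfix _ fun a ha => ?_
        rw [hP]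
        refine (condExpOp_eq_zero_iff hσ hm hnn hi hrep ha _).2
          ((integrate_congr_ae hmulF _).trans ?_)
        filter_upwards [hrep a ha, hρrep a ha, ae_integrable_updateFinset hi (args a)ᶜ,
          ae_integrable_updateFinset hρ.integrable (args a)ᶜ] with z h1 h2 h3 h4
        unfold integrate at h1 h2 ⊢
        rw [integral_sub h4 h3, h1, h2]
        simp
      have hρeq : ρ =ᵐ[Measure.pi ν] fun z => ρ₀ z * (1 + 1 * Pi (hhi.toL1 _) z) := by
        rw [hPF]
        filter_upwards [hmulF] with z hz
        rw [one_mul, mul_add, hz]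
        ring
      -- `h` is its own preimage under `Pi`, so `f = h` and `t = 1`; the range condition is just the
      -- nonnegativity of `ρ`.
      refine ⟨hhi.toL1 _, 1, (hrange _ _).1 ?_, hρeq⟩
      filter_upwards [hρeq, hρ.nonneg] with z h1 h2
      rwa [← h1]
    · rintro ⟨f, t, ht, hρ⟩
      refine ⟨⟨(hadd f t).1.congr hρ.symm, ?_, ?_⟩, ?_, ?_⟩
      · filter_upwards [hρ, (hrange f t).2 ht] with z h1 h2
        rwa [h1]
      · have h1 : ∫ z, ρ₀ z * Pi f z ∂Measure.pi ν = 0 := by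
          rw [← integral_weighted hm hnn, hintPi]
        have h2 := (integrable_weighted_iff hm hnn).1 (L1.integrable_coeFn (Pi f))
        have h3 : ∫ z, ρ₀ z * (1 + t * Pi f z) ∂Measure.pi ν =
            ∫ z, ρ₀ z + t * (ρ₀ z * Pi f z) ∂Measure.pi ν := by
          congr 1; ext z; ring
        rw [integral_congr_ae hρ, h3, integral_add hi (h2.const_mul t), integral_const_mul, h1,
          hint, mul_zero, add_zero]
      · exact fun a ha => (integrate_congr_ae hρ _).trans ((hadd f t).2 a ha)
      · filter_upwards [hρ] with z hz h0
        have h1 : ρ₀ z = 0 := by rw [hρ₀, rho0_eq, h0, mul_zero]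
        rw [hz, h1, zero_mul]
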